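/- **Conventions.** Let $M$ be a complex manifold with sheaf $\mathcal O_M$ of holomorphic functions and sheaves $\Omega_M^j$ of holomorphic $j$-forms. Let $\mathfrak g=T_M[-1]\oplus\mathfrak g_2[-2]\oplus\cdots\oplus\mathfrak g_{N}[-N]$ be a graded holomorphic vector bundle of finite rank on $M$ whose degree-one part is the tangent bundle. Its shifted dual is $\mathfrak g^\vee[-1]=\Omega_M\oplus\mathcal W$, where $\mathcal W=(\mathfrak g^{\ge 2})^\vee[-1]$, so $\Omega_M$ sits in degree $0$ and $\mathfrak g_k^\vee$ in degree $-(k-1)$. Put $C^*\mathfrak g=\hat S(\mathfrak g^\vee[-1])=\hat S(\Omega_M)\otimes\hat S(\mathcal W)$, the completed graded symmetric algebra over $\mathcal O_M$; its grading is called the cohomological degree. A (possibly curved) $L_\infty$ structure on $\mathfrak g$ is an $\mathcal O_M$-linear derivation $Q$ of $C^*\mathfrak g$ of cohomological degree $1$ with $Q^2=0$. It is extended $\Omega_M^*$-linearly (with the Koszul sign) to $\Omega_M^*\otimes_{\mathcal O_M}C^*\mathfrak g$. A Grothendieck connection is a flat connection $D:C^*\mathfrak g\to\Omega_M\otimes C^*\mathfrak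 g$ of cohomological degree $0$ such that (a) $D(ab)=Da\cdot b+(-1)^{|a|}a\cdot Db$; (b) the component $\Omega_M\to\Omega_M\otimes 1$ of $D$ is $\alpha\mapsto\alpha\otimes 1$; (c) $[D,Q]=0$. It is extended to the de Rham complex $\Omega_M^*\otimes C^*\mathfrak g$ in the usual way. An $L_\infty$ space is a triple $(M,\mathfrak g,D)$ consisting of such an $M$, such a $\mathfrak g$ with an $L_\infty$ structure, and a Grothendieck connection $D$. Its Chevalley–Eilenberg complex is $$C^*(\mathfrak g,D)=\bigl(\Omega_M^*\otimes_{\mathcal O_M}C^*\mathfrak g,\;Q+D\bigr),$$ graded by the sum of the form degree and the cohomological degree. On $\hat S(\mathcal W)$, the Chevalley–Eilenberg algebra of the sub-$L_\infty$-algebra $\mathfrak g^{\ge2}\subset\mathfrak g$, denote again by $Q$ its Chevalley–Eilenberg differential, namely $Q$ followed by the projection $C^*\mathfrak g\to\hat S(\mathcal W)$ that sets the generators in $\Omega_M$ to zero. **Theorem 3.6.** Let $(M,\mathfrak g,D)$ be an $L_\infty$ space. Then $(\hat S(\mathcal W),Q)$ is a complex, and there exists a homotopy equivalence $$C^*(\mathfrak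 g,D)\;\simeq\;\bigl(\hat S(\mathcal W),Q\bigr)$$ of complexes of sheaves of complex vector spaces on $M$. -/

import Mathlib

open Bundle TopologicalSpace CategoryTheory Opposite
open scoped Manifold ContDiff TensorProduct

noncomputable section

namespace LInfty

/-! ### The fibre: the free graded-commutative algebra

`T` is a tangent space and `G k` (`k : Fin r`) is the fibre of `𝔤_{k+2}`, the summand of the graded
bundle `𝔤 = T[-1] ⊕ 𝔤_2[-2] ⊕ ⋯ ⊕ 𝔤_{r+1}[-(r+1)]` of degree `k + 2`.  The algebra
`Λ T^∨ ⊗ S(𝔤^∨[-1])` is the free graded-commutative algebra on three kinds of generators: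

* `α ∈ T^∨` as a differential form: form degree `1`, cohomological degree `0`;
* `α ∈ T^∨ = (T[-1])^∨[-1]` as a linear function on `𝔤[1]`: form degree `0`,
  cohomological degree `0`;
* `β ∈ (G k)^∨`, which is the piece `(𝔤_{k+2}[-(k+2)])^∨[-1]` of `𝒲 = (𝔤^{≥2})^∨[-1]`:
  form degree `0`, cohomological degree `-(k+1)`.

Signs follow the total degree (form degree plus cohomological degree), so the free
graded-commutative algebra is the symmetric algebra on the generators of even total degree,
tensored with the exterior algebra on the generators of odd total degree. -/

section Fibre

variable (T : Type*) [AddCommGroup T] [Module ℂ T] [TopologicalSpace T] [IsTopologicalAddGroup T]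
  [ContinuousSMul ℂ T]
  {r : ℕ} (G : Fin r → Type*) [∀ k, AddCommGroup (G k)] [∀ k, Module ℂ (G k)]
  [∀ k, TopologicalSpace (G k)] [∀ k, IsTopologicalAddGroup (G k)] [∀ k, ContinuousSMul ℂ (G k)]

/-- Generators of even total degree. -/
abbrev EvenGen : Type _ := (T →L[ℂ] ℂ) × (∀ k : {k : Fin r // Odd (k : ℕ)}, G k →L[ℂ] ℂ)

/-- Generators of odd total degree. -/
abbrev OddGen : Type _ := (T →L[ℂ] ℂ) × (∀ k : {k : Fin r // Even (k : ℕ)}, G k →L[ℂ] ℂ)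

/-- The (uncompleted) algebra `Λ T^∨ ⊗ S(T^∨ ⊕ 𝒲)`. -/
def FibreAlg : Type _ := SymmetricAlgebra ℂ (EvenGen T G) ⊗[ℂ] ExteriorAlgebra ℂ (OddGen T G)

instance : Ring (FibreAlg T G) :=
  inferInstanceAs (Ring (SymmetricAlgebra ℂ (EvenGen T G) ⊗[ℂ] ExteriorAlgebra ℂ (OddGen T G)))

instance : Algebra ℂ (FibreAlg T G) :=
  inferInstanceAs (Algebra ℂ (SymmetricAlgebra ℂ (EvenGen T G) ⊗[ℂ] ExteriorAlgebra ℂ (OddGen T G)))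

variable {T}

/-- A covector as a differential form. -/
def formGen (α : T →L[ℂ] ℂ) : FibreAlg T G :=
  (1 : SymmetricAlgebra ℂ (EvenGen T G)) ⊗ₜ[ℂ] ExteriorAlgebra.ι ℂ ((α, 0) : OddGen T G)

/-- A covector as a generator of the symmetric algebra. -/
def symGen (α : T →L[ℂ] ℂ) : FibreAlg T G :=
  SymmetricAlgebra.ι ℂ (EvenGen T G) (α, 0) ⊗ₜ[ℂ] (1 : ExteriorAlgebra ℂ (OddGen T G))

variable (T) {G}

/-- The generator of cohomological degree `-(k+1)` given by an element of the dual of `G k`. -/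
def wGen (k : Fin r) (β : G k →L[ℂ] ℂ) : FibreAlg T G :=
  if h : Odd (k : ℕ) then
    SymmetricAlgebra.ι ℂ (EvenGen T G)
      (0, Pi.single (M := fun k : {k : Fin r // Odd (k : ℕ)} ↦ G k →L[ℂ] ℂ) ⟨k, h⟩ β) ⊗ₜ[ℂ]
        (1 : ExteriorAlgebra ℂ (OddGen T G))
  else
    (1 : SymmetricAlgebra ℂ (EvenGen T G)) ⊗ₜ[ℂ] ExteriorAlgebra.ι ℂ ((0, Pi.single
      (M := fun k : {k : Fin r // Even (k : ℕ)} ↦ G k →L[ℂ] ℂ)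
      ⟨k, Nat.not_odd_iff_even.1 h⟩ β) : OddGen T G)

end Fibre

/-- Multidegrees `m`: `m 0` is the form degree, `m 1` is the number of factors from `Ω_M` in the
symmetric algebra, and `-(m 2)` is the cohomological degree. -/
abbrev Deg : Type := Fin 3 →₀ ℕ

variable (E : Type*) [NormedAddCommGroup E] [NormedSpace ℂ E]
  {M : Type*} [TopologicalSpace M] [ChartedSpace E M] [IsManifold 𝓘(ℂ, E) ω M]
  {r : ℕ} (F : Fin r → Type*) [∀ k, NormedAddCommGroup (F k)] [∀ k, NormedSpace ℂ (F k)]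
  (𝔤 : Fin r → M → Type*) [∀ k, TopologicalSpace (TotalSpace (F k) (𝔤 k))]
  [∀ k x, AddCommGroup (𝔤 k x)] [∀ k x, Module ℂ (𝔤 k x)] [∀ k x, TopologicalSpace (𝔤 k x)]
  [∀ k x, IsTopologicalAddGroup (𝔤 k x)] [∀ k x, ContinuousSMul ℂ (𝔤 k x)]
  [∀ k, FiberBundle (F k) (𝔤 k)] [∀ k, VectorBundle ℂ (F k) (𝔤 k)]

/-- The fibre at `x` of `Λ Ω_M ⊗ S(𝔤^∨[-1])`. -/
abbrev AlgAt (E : Type*) [NormedAddCommGroup E] [NormedSpace ℂ E]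
    {M : Type*} [TopologicalSpace M] [ChartedSpace E M]
    {r : ℕ} (𝔤 : Fin r → M → Type*)
    [∀ k x, AddCommGroup (𝔤 k x)] [∀ k x, Module ℂ (𝔤 k x)] [∀ k x, TopologicalSpace (𝔤 k x)]
    [∀ k x, IsTopologicalAddGroup (𝔤 k x)] [∀ k x, ContinuousSMul ℂ (𝔤 k x)] (x : M) : Type _ :=
  FibreAlg (TangentSpace 𝓘(ℂ, E) x) (fun k ↦ 𝔤 k x)

/-- Arbitrary sections over `U` of the bundle of algebras `Λ Ω_M ⊗ S(𝔤^∨[-1])`; algebra operations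
are pointwise. -/
def Sec (E : Type*) [NormedAddCommGroup E] [NormedSpace ℂ E]
    {M : Type*} [TopologicalSpace M] [ChartedSpace E M]
    {r : ℕ} (𝔤 : Fin r → M → Type*)
    [∀ k x, AddCommGroup (𝔤 k x)] [∀ k x, Module ℂ (𝔤 k x)] [∀ k x, TopologicalSpace (𝔤 k x)]
    [∀ k x, IsTopologicalAddGroup (𝔤 k x)] [∀ k x, ContinuousSMul ℂ (𝔤 k x)]
    (U : Opens M) : Type _ :=
  ∀ x : U, AlgAt E 𝔤 (x : M)

section Sec

variable (E : Type*) [NormedAddCommGroup E] [NormedSpace ℂ E]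
  {M : Type*} [TopologicalSpace M] [ChartedSpace E M]
  {r : ℕ} (𝔤 : Fin r → M → Type*)
  [∀ k x, AddCommGroup (𝔤 k x)] [∀ k x, Module ℂ (𝔤 k x)] [∀ k x, TopologicalSpace (𝔤 k x)]
  [∀ k x, IsTopologicalAddGroup (𝔤 k x)] [∀ k x, ContinuousSMul ℂ (𝔤 k x)]

instance (U : Opens M) : Ring (Sec E 𝔤 U) := inferInstanceAs (Ring (∀ x : U, AlgAt E 𝔤 (x : M)))

instance (U : Opens M) : Algebra ℂ (Sec E 𝔤 U) :=
  inferInstanceAs (Algebra ℂ (∀ x : U, AlgAt E 𝔤 (x : M)))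

/-- Restriction of sections. -/
def resSec {U V : Opens M} (h : V ≤ U) : Sec E 𝔤 U →ₐ[ℂ] Sec E 𝔤 V where
  toFun s x := s ⟨x, h x.2⟩
  map_one' := rfl
  map_mul' _ _ := rfl
  map_zero' := rfl
  map_add' _ _ := rfl
  commutes' _ := rfl

/-- Formal series `∑ₘ aₘ tᵐ` of sections over `U`.  The variables `t` only keep track of the
multidegree: a series stands for the element `(aₘ)ₘ` of a product over all multidegrees. -/
abbrev Series (U : Opens M) : Type _ := MvPowerSeries (Fin 3) (Sec E 𝔤 U)

end Sec

/-- `α` is a holomorphic section over `V` of the dual of the vector bundle `B`. -/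
def IsHolDual (E : Type*) [NormedAddCommGroup E] [NormedSpace ℂ E]
    {M : Type*} [TopologicalSpace M] [ChartedSpace E M]
    (F : Type*) [NormedAddCommGroup F] [NormedSpace ℂ F] {B : M → Type*}
    [TopologicalSpace (TotalSpace F B)] [∀ x, AddCommGroup (B x)] [∀ x, Module ℂ (B x)]
    [∀ x, TopologicalSpace (B x)] [FiberBundle F B] [VectorBundle ℂ F B]
    (V : Opens M) (α : ∀ x, B x →L[ℂ] ℂ) : Prop :=
  ContMDiffOn 𝓘(ℂ, E) (𝓘(ℂ, E).prod 𝓘(ℂ, F →L[ℂ] ℂ)) ω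
    (fun x ↦ TotalSpace.mk' (F →L[ℂ] ℂ) (E := fun x ↦ B x →L[ℂ] Bundle.Trivial M ℂ x) x (α x)) V

/-- `HolPoly E F 𝔤 V m s`: over `V`, the section `s` of the bundle of algebras
`Λ Ω_M ⊗ S(𝔤^∨[-1])` is a polynomial expression, homogeneous of multidegree `m`, in holomorphic
functions, holomorphic one-forms (as forms and as symmetric generators) and holomorphic sections of
the duals of the bundles `𝔤 k`. -/
inductive HolPoly (V : Opens M) : Deg → Sec E 𝔤 V → Prop
  | zero (m : Deg) : HolPoly V m 0
  | fn (f : M → ℂ) (hf : ContMDiffOn 𝓘(ℂ, E) 𝓘(ℂ, ℂ) ω f V) :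
      HolPoly V 0 (fun x ↦ algebraMap ℂ _ (f x))
  | form (α : ∀ x : M, TangentSpace 𝓘(ℂ, E) x →L[ℂ] ℂ) (hα : IsHolDual E E V α) :
      HolPoly V (Finsupp.single 0 1) (fun x ↦ formGen _ (α x))
  | sym (α : ∀ x : M, TangentSpace 𝓘(ℂ, E) x →L[ℂ] ℂ) (hα : IsHolDual E E V α) :
      HolPoly V (Finsupp.single 1 1) (fun x ↦ symGen _ (α x))
  | w (k : Fin r) (β : ∀ x : M, 𝔤 k x →L[ℂ] ℂ) (hβ : IsHolDual E (F k) V β) :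
      HolPoly V (Finsupp.single 2 ((k : ℕ) + 1)) (fun x ↦ wGen (G := fun k ↦ 𝔤 k x) _ k (β x))
  | add (m : Deg) (s t : Sec E 𝔤 V) :
      HolPoly V m s → HolPoly V m t → HolPoly V m (s + t)
  | mul (m n : Deg) (s t : Sec E 𝔤 V) :
      HolPoly V m s → HolPoly V n t → HolPoly V (m + n) (s * t)

/-- Holomorphic sections over `U` of the finite rank bundle of elements of multidegree `m`. -/
def IsHol (U : Opens M) (m : Deg) (s : Sec E 𝔤 U) : Prop :=
  ∀ x ∈ U, ∃ (V : Opens M) (h : V ≤ U), x ∈ V ∧ HolPoly E F 𝔤 V m (resSec E 𝔤 h s)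

variable {E F 𝔤} in
lemma HolPoly.res {V W : Opens M} (h : W ≤ V) {m : Deg} {s : Sec E 𝔤 V}
    (hs : HolPoly E F 𝔤 V m s) : HolPoly E F 𝔤 W m (resSec E 𝔤 h s) := by
  induction hs with
  | zero m => exact HolPoly.zero m
  | fn f hf => exact HolPoly.fn f (hf.mono h)
  | form α hα => exact HolPoly.form α (ContMDiffOn.mono hα h)
  | sym α hα => exact HolPoly.sym α (ContMDiffOn.mono hα h)
  | w k β hβ => exact HolPoly.w k β (ContMDiffOn.mono hβ h)
  | add m s t _ _ hs ht => exact HolPoly.add m _ _ hs ht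
  | mul m n s t _ _ hs ht => exact HolPoly.mul m n _ _ hs ht

variable {E F 𝔤} in
lemma IsHol.res {U V : Opens M} (h : V ≤ U) {m : Deg} {s : Sec E 𝔤 U}
    (hs : IsHol E F 𝔤 U m s) : IsHol E F 𝔤 V m (resSec E 𝔤 h s) := by
  intro x hx
  obtain ⟨W, hW, hxW, hp⟩ := hs x (h hx)
  exact ⟨W ⊓ V, inf_le_right, ⟨hxW, hx⟩, hp.res (inf_le_left : W ⊓ V ≤ W)⟩

variable {E F 𝔤} in
lemma IsHol.zero (U : Opens M) (m : Deg) : IsHol E F 𝔤 U m 0 :=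
  fun _ hx ↦ ⟨U, le_rfl, hx, HolPoly.zero m⟩

variable {E F 𝔤} in
lemma IsHol.add {U : Opens M} {m : Deg} {s t : Sec E 𝔤 U}
    (hs : IsHol E F 𝔤 U m s) (ht : IsHol E F 𝔤 U m t) : IsHol E F 𝔤 U m (s + t) := by
  intro x hx
  obtain ⟨V, hV, hxV, hp⟩ := hs x hx
  obtain ⟨W, hW, hxW, hq⟩ := ht x hx
  exact ⟨V ⊓ W, inf_le_left.trans hV, ⟨hxV, hxW⟩,
    HolPoly.add m _ _ (hp.res (inf_le_left : V ⊓ W ≤ V)) (hq.res (inf_le_right : V ⊓ W ≤ W))⟩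

variable {E F 𝔤} in
lemma IsHol.mul {U : Opens M} {m n : Deg} {s t : Sec E 𝔤 U}
    (hs : IsHol E F 𝔤 U m s) (ht : IsHol E F 𝔤 U n t) : IsHol E F 𝔤 U (m + n) (s * t) := by
  intro x hx
  obtain ⟨V, hV, hxV, hp⟩ := hs x hx
  obtain ⟨W, hW, hxW, hq⟩ := ht x hx
  exact ⟨V ⊓ W, inf_le_left.trans hV, ⟨hxV, hxW⟩,
    HolPoly.mul m n _ _ (hp.res (inf_le_left : V ⊓ W ≤ V)) (hq.res (inf_le_right : V ⊓ W ≤ W))⟩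

variable {E F 𝔤} in
lemma IsHol.const (U : Opens M) (c : ℂ) :
    IsHol E F 𝔤 U 0 (algebraMap ℂ (Sec E 𝔤 U) c) :=
  fun _ hx ↦ ⟨U, le_rfl, hx, HolPoly.fn (fun _ ↦ c) contMDiffOn_const⟩

/-- The sections over `U` of `Ω_M^* ⊗ C^*𝔤 = Λ Ω_M ⊗ Ŝ(𝔤^∨[-1])`: families `(aₘ)ₘ` of holomorphic
sections `aₘ` of multidegree `m`.  As `U` varies these form a sheaf of `ℂ`-algebras. -/
def CEAlg (U : Opens M) : Subalgebra ℂ (Series E 𝔤 U) where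
  carrier := {a | ∀ m, IsHol E F 𝔤 U m (MvPowerSeries.coeff m a)}
  zero_mem' m := by simpa using IsHol.zero U m
  one_mem' m := by
    classical
    rw [MvPowerSeries.coeff_one]
    split_ifs with h
    · subst h
      simpa using IsHol.const (E := E) (F := F) (𝔤 := 𝔤) U 1
    · exact IsHol.zero U m
  add_mem' ha hb m := by simpa using (ha m).add (hb m)
  mul_mem' {a b} ha hb m := by
    classical
    rw [MvPowerSeries.coeff_mul]
    refine Finset.sum_induction _ (IsHol E F 𝔤 U m) (fun _ _ ↦ IsHol.add) (IsHol.zero U m) ?_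
    intro p hp
    rw [← Finset.HasAntidiagonal.mem_antidiagonal.1 hp]
    exact (ha p.1).mul (hb p.2)
  algebraMap_mem' c m := by
    classical
    rw [MvPowerSeries.algebraMap_apply, MvPowerSeries.coeff_C]
    split_ifs with h
    · subst h
      exact IsHol.const U c
    · exact IsHol.zero U m

/-- Restriction of sections of `Ω_M^* ⊗ C^*𝔤`. -/
def res {U V : Opens M} (h : V ≤ U) : CEAlg E F 𝔤 U →ₗ[ℂ] CEAlg E F 𝔤 V where
  toFun a := ⟨MvPowerSeries.map (resSec E 𝔤 h : _ →ₐ[ℂ] _).toRingHom a.1, fun m ↦ by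
    rw [MvPowerSeries.coeff_map]
    exact (a.2 m).res h⟩
  map_add' a b := by ext; simp
  map_smul' c a := by
    apply Subtype.ext
    ext m : 1
    simp only [MvPowerSeries.coeff_map]
    rfl

/-- The coefficients of `trunc S a`. -/
def truncFun {U : Opens M} (S : Deg → Prop) (a : Series E 𝔤 U) : Series E 𝔤 U :=
  open Classical in fun m ↦ if S m then MvPowerSeries.coeff m a else 0

lemma coeff_truncFun_of_pos {U : Opens M} {S : Deg → Prop} {m : Deg} (h : S m)
    (a : Series E 𝔤 U) :
    MvPowerSeries.coeff m (truncFun E 𝔤 S a) = MvPowerSeries.coeff m a :=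
  if_pos h

lemma coeff_truncFun_of_neg {U : Opens M} {S : Deg → Prop} {m : Deg} (h : ¬ S m)
    (a : Series E 𝔤 U) :
    MvPowerSeries.coeff m (truncFun E 𝔤 S a) = 0 :=
  if_neg h

/-- `trunc S a` keeps the components of `a` whose multidegree satisfies `S` and drops the others. -/
def trunc {U : Opens M} (S : Deg → Prop) : CEAlg E F 𝔤 U →ₗ[ℂ] CEAlg E F 𝔤 U where
  toFun a := ⟨truncFun E 𝔤 S a.1, fun m ↦ by
    by_cases h : S m
    · rw [coeff_truncFun_of_pos E 𝔤 h]
      exact a.2 m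
    · rw [coeff_truncFun_of_neg E 𝔤 h]
      exact IsHol.zero U m⟩
  map_add' a b := by
    apply Subtype.ext
    ext m : 1
    by_cases h : S m
    · simp [coeff_truncFun_of_pos E 𝔤 h]
    · simp [coeff_truncFun_of_neg E 𝔤 h]
  map_smul' c a := by
    apply Subtype.ext
    ext m : 1
    show MvPowerSeries.coeff m (truncFun E 𝔤 S (c • a.1)) =
      c • MvPowerSeries.coeff m (truncFun E 𝔤 S a.1)
    by_cases h : S m
    · rw [coeff_truncFun_of_pos E 𝔤 h, coeff_truncFun_of_pos E 𝔤 h]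
      rfl
    · rw [coeff_truncFun_of_neg E 𝔤 h, coeff_truncFun_of_neg E 𝔤 h, smul_zero]

/-- The elements all of whose components have a multidegree satisfying `S`. -/
def supp (U : Opens M) (S : Deg → Prop) : Submodule ℂ (CEAlg E F 𝔤 U) where
  carrier := {a | ∀ m, ¬ S m → MvPowerSeries.coeff m a.1 = 0}
  zero_mem' m _ := by simp
  add_mem' ha hb m hm := by simp [ha m hm, hb m hm]
  smul_mem' c a ha m hm := by
    show c • MvPowerSeries.coeff m a.1 = 0
    rw [ha m hm, smul_zero]

/-- Form degree `j` and cohomological degree `-i`. -/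
def bideg (j i : ℕ) (m : Deg) : Prop := m 0 = j ∧ m 2 = i

variable [∀ k, ContMDiffVectorBundle ω (F k) (𝔤 k) 𝓘(ℂ, E)]

/-- A (possibly curved) `L_∞` structure on the graded holomorphic vector bundle
`𝔤 = T_M[-1] ⊕ 𝔤_2[-2] ⊕ ⋯`: a derivation `Q` of cohomological degree `1` and square zero of its
Chevalley--Eilenberg algebra `C^*𝔤 = Ŝ(𝔤^∨[-1])`.  We record directly the `Ω_M^*`-linear extension
of `Q` to `Ω_M^* ⊗ C^*𝔤` (with the Koszul sign).  Linearity over `Ω_M^*` need not be required: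
`Q` kills functions and forms since `Ω_M^* ⊗ C^*𝔤` vanishes in positive cohomological degree. -/
structure LInftyStructure (E : Type*) [NormedAddCommGroup E] [NormedSpace ℂ E]
    {M : Type*} [TopologicalSpace M] [ChartedSpace E M] [IsManifold 𝓘(ℂ, E) ω M]
    {r : ℕ} (F : Fin r → Type*) [∀ k, NormedAddCommGroup (F k)] [∀ k, NormedSpace ℂ (F k)]
    (𝔤 : Fin r → M → Type*) [∀ k, TopologicalSpace (TotalSpace (F k) (𝔤 k))]
    [∀ k x, AddCommGroup (𝔤 k x)] [∀ k x, Module ℂ (𝔤 k x)] [∀ k x, TopologicalSpace (𝔤 k x)]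
    [∀ k x, IsTopologicalAddGroup (𝔤 k x)] [∀ k x, ContinuousSMul ℂ (𝔤 k x)]
    [∀ k, FiberBundle (F k) (𝔤 k)] [∀ k, VectorBundle ℂ (F k) (𝔤 k)]
    [∀ k, ContMDiffVectorBundle ω (F k) (𝔤 k) 𝓘(ℂ, E)] where
  Q : ∀ U : Opens M, CEAlg E F 𝔤 U →ₗ[ℂ] CEAlg E F 𝔤 U
  Q_res : ∀ {U V : Opens M} (h : V ≤ U) (a : CEAlg E F 𝔤 U),
    Q V (res E F 𝔤 h a) = res E F 𝔤 h (Q U a)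
  /-- `Q` preserves the form degree and raises the cohomological degree by one. -/
  Q_deg : ∀ (U : Opens M) (j i : ℕ) (a : CEAlg E F 𝔤 U),
    trunc E F 𝔤 (bideg j i) (Q U a) = Q U (trunc E F 𝔤 (bideg j (i + 1)) a)
  Q_mul : ∀ (U : Opens M) (j i : ℕ) (a b : CEAlg E F 𝔤 U), a ∈ supp E F 𝔤 U (bideg j i) →
    Q U (a * b) = Q U a * b + (-1 : ℂ) ^ (j + i) • (a * Q U b)
  Q_sq : ∀ (U : Opens M) (a : CEAlg E F 𝔤 U), Q U (Q U a) = 0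

variable {E F 𝔤}

/-- A Grothendieck connection: a flat connection `D : C^*𝔤 → Ω_M ⊗ C^*𝔤` of cohomological degree
zero which is a derivation, satisfies the normalisation `D_sym`, and commutes (in the graded sense)
with `Q`.  We record directly its extension to the de Rham complex `Ω_M^* ⊗ C^*𝔤`, an odd
derivation of square zero with `D f = df` on functions; it follows that `D` is the de Rham
differential on `Ω_M^*`. -/
structure GrothendieckConnection (L : LInftyStructure E F 𝔤) where
  D : ∀ U : Opens M, CEAlg E F 𝔤 U →ₗ[ℂ] CEAlg E F 𝔤 U
  D_res : ∀ {U V : Opens M} (h : V ≤ U) (a : CEAlg E F 𝔤 U),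
    D V (res E F 𝔤 h a) = res E F 𝔤 h (D U a)
  /-- `D` raises the form degree by one and preserves the cohomological degree. -/
  D_deg : ∀ (U : Opens M) (j i : ℕ) (a : CEAlg E F 𝔤 U),
    trunc E F 𝔤 (bideg (j + 1) i) (D U a) = D U (trunc E F 𝔤 (bideg j i) a)
  D_deg_zero : ∀ (U : Opens M) (i : ℕ) (a : CEAlg E F 𝔤 U),
    trunc E F 𝔤 (bideg 0 i) (D U a) = 0
  D_mul : ∀ (U : Opens M) (j i : ℕ) (a b : CEAlg E F 𝔤 U), a ∈ supp E F 𝔤 U (bideg j i) →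
    D U (a * b) = D U a * b + (-1 : ℂ) ^ (j + i) • (a * D U b)
  /-- `D f = df` for a holomorphic function `f`. -/
  D_fn : ∀ (U : Opens M) (a : CEAlg E F 𝔤 U) (f : M → ℂ),
    ContMDiffOn 𝓘(ℂ, E) 𝓘(ℂ, ℂ) ω f U →
    a.1 = MvPowerSeries.monomial 0 (fun x : U ↦ algebraMap ℂ (AlgAt E 𝔤 (x : M)) (f x)) →
    (D U a).1 = MvPowerSeries.monomial (Finsupp.single 0 1)
      (fun x : U ↦ formGen (fun k ↦ 𝔤 k x) (mfderiv 𝓘(ℂ, E) 𝓘(ℂ, ℂ) f (x : M)))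
  /-- The component `Ω_M → Ω_M ⊗ 1` of `D` is `α ↦ α ⊗ 1`. -/
  D_sym : ∀ (U : Opens M) (a : CEAlg E F 𝔤 U)
    (α : ∀ x : M, TangentSpace 𝓘(ℂ, E) x →L[ℂ] ℂ), IsHolDual E E U α →
    a.1 = MvPowerSeries.monomial (Finsupp.single 1 1)
      (fun x : U ↦ symGen (fun k ↦ 𝔤 k x) (α x)) →
    MvPowerSeries.coeff (Finsupp.single 0 1) (D U a).1 =
      (fun x : U ↦ formGen (fun k ↦ 𝔤 k x) (α x))
  D_sq : ∀ (U : Opens M) (a : CEAlg E F 𝔤 U), D U (D U a) = 0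
  D_Q : ∀ (U : Opens M) (a : CEAlg E F 𝔤 U), D U (L.Q U a) + L.Q U (D U a) = 0

/-- Total degree `n`, the sum of the form degree and the cohomological degree. -/
def totDeg (n : ℤ) (m : Deg) : Prop := (m 0 : ℤ) - m 2 = n

/-- No factor from `Ω_M`, neither as a form nor as a symmetric generator. -/
def wOnly (m : Deg) : Prop := m 0 = 0 ∧ m 1 = 0

/-- Multidegrees of the piece of `Ŝ(𝒲)` of cohomological degree `n`. -/
def wDeg (n : ℤ) (m : Deg) : Prop := wOnly m ∧ -(m 2 : ℤ) = n

variable {L : LInftyStructure E F 𝔤}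

lemma trunc_eq_zero {U : Opens M} {S S' : Deg → Prop} (h : ∀ m, S' m → ¬ S m)
    {a : CEAlg E F 𝔤 U} (ha : a ∈ supp E F 𝔤 U S) : trunc E F 𝔤 S' a = 0 := by
  apply Subtype.ext
  ext m : 1
  show MvPowerSeries.coeff m (truncFun E 𝔤 S' a.1) = MvPowerSeries.coeff m 0
  by_cases hm : S' m
  · rw [coeff_truncFun_of_pos E 𝔤 hm, ha m (h m hm)]
    rfl
  · rw [coeff_truncFun_of_neg E 𝔤 hm]
    rfl

lemma coeff_eq_trunc {U : Opens M} {S : Deg → Prop} {m : Deg} (hm : S m) (a : CEAlg E F 𝔤 U) :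
    MvPowerSeries.coeff m a.1 = MvPowerSeries.coeff m (trunc E F 𝔤 S a).1 :=
  (coeff_truncFun_of_pos E 𝔤 hm a.1).symm

lemma coeff_Q_eq_zero (L : LInftyStructure E F 𝔤) {U : Opens M} {S : Deg → Prop}
    {a : CEAlg E F 𝔤 U} (ha : a ∈ supp E F 𝔤 U S) {m : Deg}
    (h : ∀ m', bideg (m 0) (m 2 + 1) m' → ¬ S m') : MvPowerSeries.coeff m (L.Q U a).1 = 0 := by
  rw [coeff_eq_trunc (S := bideg (m 0) (m 2)) ⟨rfl, rfl⟩, L.Q_deg, trunc_eq_zero h ha, map_zero]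
  rfl

lemma coeff_D_eq_zero (D : GrothendieckConnection L) {U : Opens M} {S : Deg → Prop}
    {a : CEAlg E F 𝔤 U} (ha : a ∈ supp E F 𝔤 U S) {m : Deg}
    (h : ∀ m', m' 0 + 1 = m 0 → m' 2 = m 2 → ¬ S m') :
    MvPowerSeries.coeff m (D.D U a).1 = 0 := by
  rcases hm : m 0 with _ | j
  · rw [coeff_eq_trunc (S := bideg 0 (m 2)) ⟨hm, rfl⟩, D.D_deg_zero]
    rfl
  · rw [coeff_eq_trunc (S := bideg (j + 1) (m 2)) ⟨hm, rfl⟩, D.D_deg,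
      trunc_eq_zero (fun m' hm' ↦ h m' (by rw [hm'.1, hm]) hm'.2) ha, map_zero]
    rfl

/-- The total differential `Q + D`. -/
def totD (D : GrothendieckConnection L) (U : Opens M) : CEAlg E F 𝔤 U →ₗ[ℂ] CEAlg E F 𝔤 U :=
  L.Q U + D.D U

lemma totD_mem (D : GrothendieckConnection L) {U : Opens M} {i j : ℤ} (hij : i + 1 = j)
    {a : CEAlg E F 𝔤 U} (ha : a ∈ supp E F 𝔤 U (totDeg i)) :
    totD D U a ∈ supp E F 𝔤 U (totDeg j) := by
  refine Submodule.add_mem _ (fun m hm ↦ coeff_Q_eq_zero L ha ?_)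
    (fun m hm ↦ coeff_D_eq_zero D ha ?_)
  · rintro m' ⟨h0, h2⟩ h
    apply hm
    simp only [totDeg] at h ⊢
    omega
  · intro m' h0 h2 h
    apply hm
    simp only [totDeg] at h ⊢
    omega

lemma totD_totD (D : GrothendieckConnection L) (U : Opens M) (a : CEAlg E F 𝔤 U) :
    totD D U (totD D U a) = 0 := by
  have h := D.D_Q U a
  simp only [totD, LinearMap.add_apply, map_add, L.Q_sq, D.D_sq, zero_add, add_zero]
  exact h

lemma res_mem {U V : Opens M} (h : V ≤ U) {S : Deg → Prop} {a : CEAlg E F 𝔤 U}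
    (ha : a ∈ supp E F 𝔤 U S) : res E F 𝔤 h a ∈ supp E F 𝔤 V S := by
  intro m hm
  show MvPowerSeries.coeff m (MvPowerSeries.map _ a.1) = 0
  rw [MvPowerSeries.coeff_map, ha m hm, map_zero]

variable (E F 𝔤) in
/-- The sheaf of complex vector spaces `U ↦ {a ∈ (Ω_M^* ⊗ C^*𝔤)(U) | a` has multidegrees in `S}`. -/
def suppSheaf (S : Deg → Prop) : TopCat.Presheaf (ModuleCat ℂ) (TopCat.of M) where
  obj U := ModuleCat.of ℂ (supp E F 𝔤 U.unop S)
  map {U V} f := ModuleCat.ofHom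
    ((res E F 𝔤 (leOfHom f.unop)).restrict (p := supp E F 𝔤 U.unop S) (q := supp E F 𝔤 V.unop S)
      (fun _ ha ↦ res_mem _ ha))
  map_id _ := rfl
  map_comp _ _ := rfl

/-- The morphism of sheaves induced by operators that send `S` to `S'`. -/
def suppMap {S S' : Deg → Prop} (f : ∀ U : Opens M, CEAlg E F 𝔤 U →ₗ[ℂ] CEAlg E F 𝔤 U)
    (hres : ∀ {U V : Opens M} (h : V ≤ U) (a : CEAlg E F 𝔤 U),
      f V (res E F 𝔤 h a) = res E F 𝔤 h (f U a))
    (hf : ∀ (U : Opens M) (a : CEAlg E F 𝔤 U), a ∈ supp E F 𝔤 U S → f U a ∈ supp E F 𝔤 U S') :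
    suppSheaf E F 𝔤 S ⟶ suppSheaf E F 𝔤 S' where
  app U := ModuleCat.ofHom ((f U.unop).restrict (hf U.unop))
  naturality U V g := by
    ext a
    apply Subtype.ext
    exact hres (leOfHom g.unop) a.1

/-- The Chevalley--Eilenberg complex `C^*(𝔤, D)`: the de Rham complex `Ω_M^* ⊗ C^*𝔤` with the total
differential `Q + D`, graded by total degree, a complex of sheaves of complex vector spaces.
(Complexes of sheaves are a full subcategory of complexes of presheaves.) -/
def ceComplex (D : GrothendieckConnection L) :
    CochainComplex (TopCat.Presheaf (ModuleCat ℂ) (TopCat.of M)) ℤ where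
  X n := suppSheaf E F 𝔤 (totDeg n)
  d i j := if h : i + 1 = j then
      suppMap (totD D) (fun h a ↦ by
        simp only [totD, LinearMap.add_apply, L.Q_res, D.D_res, map_add])
        (fun _ _ ha ↦ totD_mem D h ha)
    else 0
  shape i j h := dif_neg h
  d_comp_d' i j k hij hjk := by
    rw [dif_pos (show i + 1 = j from hij), dif_pos (show j + 1 = k from hjk)]
    ext U a
    apply Subtype.ext
    exact totD_totD D _ _

/-- The differential of `Ŝ(𝒲)`, the Chevalley--Eilenberg differential of the sub-`L_∞`-algebra
`𝔤^{≥2}` of `𝔤`.  On `Ŝ(𝒲) ⊆ C^*𝔤` it is `Q` followed by the restriction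
`C^*𝔤 → C^*(𝔤^{≥2}) = Ŝ(𝒲)`, which sets the generators in `Ω_M` to zero. -/
def wQ (L : LInftyStructure E F 𝔤) (U : Opens M) : CEAlg E F 𝔤 U →ₗ[ℂ] CEAlg E F 𝔤 U :=
  trunc E F 𝔤 wOnly ∘ₗ L.Q U

lemma wQ_mem (L : LInftyStructure E F 𝔤) {U : Opens M} {i j : ℤ} (hij : i + 1 = j)
    {a : CEAlg E F 𝔤 U} (ha : a ∈ supp E F 𝔤 U (wDeg i)) :
    wQ L U a ∈ supp E F 𝔤 U (wDeg j) := by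
  intro m hm
  show MvPowerSeries.coeff m (truncFun E 𝔤 wOnly (L.Q U a).1) = 0
  by_cases hw : wOnly m
  · rw [coeff_truncFun_of_pos E 𝔤 hw]
    refine coeff_Q_eq_zero L ha ?_
    rintro m' ⟨h0, h2⟩ ⟨-, h⟩
    refine hm ⟨hw, ?_⟩
    omega
  · exact coeff_truncFun_of_neg E 𝔤 hw _

lemma wQ_res (L : LInftyStructure E F 𝔤) {U V : Opens M} (h : V ≤ U) (a : CEAlg E F 𝔤 U) :
    wQ L V (res E F 𝔤 h a) = res E F 𝔤 h (wQ L U a) := by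
  apply Subtype.ext
  ext m : 1
  show MvPowerSeries.coeff m (truncFun E 𝔤 wOnly (L.Q V (res E F 𝔤 h a)).1) =
    MvPowerSeries.coeff m (MvPowerSeries.map _ (truncFun E 𝔤 wOnly (L.Q U a).1))
  rw [L.Q_res, MvPowerSeries.coeff_map]
  by_cases hw : wOnly m
  · rw [coeff_truncFun_of_pos E 𝔤 hw, coeff_truncFun_of_pos E 𝔤 hw]
    exact MvPowerSeries.coeff_map _ _ _
  · rw [coeff_truncFun_of_neg E 𝔤 hw, coeff_truncFun_of_neg E 𝔤 hw, map_zero]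

/-- The complex `(Ŝ(𝒲), Q)`, given that its differential has square zero. -/
def wComplex (L : LInftyStructure E F 𝔤)
    (hL : ∀ (n : ℤ) (U : Opens M), ∀ a ∈ supp E F 𝔤 U (wDeg n), wQ L U (wQ L U a) = 0) :
    CochainComplex (TopCat.Presheaf (ModuleCat ℂ) (TopCat.of M)) ℤ where
  X n := suppSheaf E F 𝔤 (wDeg n)
  d i j := if h : i + 1 = j then
      suppMap (wQ L) (wQ_res L) (fun _ _ ha ↦ wQ_mem L h ha)
    else 0
  shape i j h := dif_neg h
  d_comp_d' i j k hij hjk := by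
    rw [dif_pos (show i + 1 = j from hij), dif_pos (show j + 1 = k from hjk)]
    ext U a
    apply Subtype.ext
    exact hL i _ a.1 a.2

end LInfty
end

/-! The projection of `C^*(𝔤, D)` to `(Ŝ(𝒲), Q)` that sets all generators coming from `Ω_M` to zero
is a morphism of complexes with a degreewise section, so it is a homotopy equivalence as soon as its
kernel has an isomorphism that is null-homotopic. Up to terms that do not lower the number of
symmetric generators from `Ω_M`, the differential `Q + D` is the Koszul differential turning these
generators into one-forms: this is condition (b) on `D` together with the linearity of `Q` over
`Ω_M^*` and the Leibniz rules. The Koszul differential is contracted by a homotopy `H` that turns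
forms back into symmetric generators, and `H` raises the number of these by one. On the kernel
`(Q + D) H + H (Q + D)` is therefore the identity up to terms that raise this number; as power
series are complete for the filtration by this number, it is invertible. -/

noncomputable section

namespace LInfty

/-! ### Complete filtrations and degreewise split extensions -/

section CompleteFiltration

variable {R A : Type*} [Ring R] [AddCommGroup A] [Module R A]

/-- A decreasing filtration of a module by submodules that is exhaustive, Hausdorff and complete,
so that a map which is the identity up to terms of higher filtration can be inverted. -/
structure IsCompleteFiltration (F : ℕ → Submodule R A) : Prop where
  zero_eq_top : F 0 = ⊤
  antitone : Antitone F
  eq_zero_of_forall_mem : ∀ a, (∀ n, a ∈ F n) → a = 0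
  exists_limit : ∀ s : ℕ → A, (∀ n, s (n + 1) - s n ∈ F n) → ∃ a, ∀ n, a - s n ∈ F n

theorem IsCompleteFiltration.bijective {F : ℕ → Submodule R A} (hF : IsCompleteFiltration F)
    {f : A →ₗ[R] A} (hf : ∀ n, ∀ a ∈ F n, f a - a ∈ F (n + 1)) : Function.Bijective f := by
  have mem_of_map_mem (a : A) (n : ℕ) (h : ∀ k ≤ n, f a ∈ F k) : a ∈ F n := by
    induction n with
    | zero => rw [hF.zero_eq_top]; exact Submodule.mem_top
    | succ n ih =>
      have ha := hf n a (ih fun k hk ↦ h k (hk.trans n.le_succ))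
      exact sub_sub_cancel (f a) a ▸ (F (n + 1)).sub_mem (h _ le_rfl) ha
  have mem_of_map_eq_zero (a : A) (h : f a = 0) : a = 0 :=
    hF.eq_zero_of_forall_mem a fun n ↦ mem_of_map_mem a n fun k _ ↦ h ▸ (F k).zero_mem
  refine ⟨(injective_iff_map_eq_zero f).2 mem_of_map_eq_zero, fun b ↦ ?_⟩
  let s (n : ℕ) : A := Nat.rec 0 (fun _ a ↦ a + (b - f a)) n
  have s_succ (n : ℕ) : s (n + 1) - s n = b - f (s n) := add_sub_cancel_left _ _
  have residue_mem (n : ℕ) : b - f (s n) ∈ F n := by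
    induction n with
    | zero => rw [hF.zero_eq_top]; exact Submodule.mem_top
    | succ n ih =>
      have h : b - f (s (n + 1)) = -(f (s (n + 1) - s n) - (s (n + 1) - s n)) := by
        rw [map_sub, s_succ]
        abel
      rw [h, s_succ]
      exact neg_mem (hf n _ ih)
  obtain ⟨a, ha⟩ := hF.exists_limit s fun n ↦ s_succ n ▸ residue_mem n
  refine ⟨a, sub_eq_zero.1 (hF.eq_zero_of_forall_mem _ fun n ↦ ?_)⟩
  have h : f a - b = (f (a - s n) - (a - s n)) + (a - s n) - (b - f (s n)) := by
    rw [map_sub]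
    abel
  rw [h]
  exact sub_mem (add_mem (hF.antitone n.le_succ (hf n _ (ha n))) (ha n)) (residue_mem n)

end CompleteFiltration

section Homological

open Limits Pretriangulated

variable {C : Type*} [Category* C] [Preadditive C] [HasZeroObject C] [HasBinaryBiproducts C]

theorem nonempty_homotopyEquiv_of_degreewise_split (S : ShortComplex (CochainComplex C ℤ))
    (σ : ∀ n, (S.map (HomologicalComplex.eval C (ComplexShape.up ℤ) n)).Splitting)
    {φ : S.X₁ ⟶ S.X₁} (hφ : IsIso φ) (h : Homotopy φ 0) :
    Nonempty (HomotopyEquiv S.X₂ S.X₃) := by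
  let q := HomotopyCategory.quotient C (ComplexShape.up ℤ)
  have isZero_left : IsZero (q.obj S.X₁) := by
    rw [IsZero.iff_id_eq_zero, ← q.map_id, ← IsIso.inv_hom_id φ, q.map_comp,
      HomotopyCategory.eq_of_homotopy _ _ h, q.map_zero, comp_zero]
  have distinguished :=
    (HomotopyCategory.distinguished_iff_iso_trianglehOfDegreewiseSplit
      (CochainComplex.trianglehOfDegreewiseSplit S σ)).2 ⟨S, σ, ⟨Iso.refl _⟩⟩
  have : IsIso (q.map S.g) := (Triangle.isZero₁_iff_isIso₂ _ distinguished).1 isZero_left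
  exact ⟨HomotopyCategory.homotopyEquivOfIso (asIso (q.map S.g))⟩

end Homological

/-! ### Koszul differentials on free supercommutative algebras -/

section SkewDerivation

variable {R A B : Type*} [CommRing R] [Ring A] [Algebra R A] [Ring B] [Algebra R B]

/-- A linear map satisfying the Leibniz rule twisted by `σ`.  A derivation of a super algebra is
the case where `σ` is the identity (even derivations) or the parity automorphism (odd ones). -/
def IsSkewDerivation (σ : A →ₐ[R] A) (δ : A →ₗ[R] A) : Prop :=
  ∀ a b, δ (a * b) = δ a * b + σ a * δ b

namespace IsSkewDerivation

variable {σ : A →ₐ[R] A} {δ ε : A →ₗ[R] A}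

theorem map_one (h : IsSkewDerivation σ δ) : δ 1 = 0 := by
  simpa using h 1 1

theorem map_algebraMap (h : IsSkewDerivation σ δ) (r : R) : δ (algebraMap R A r) = 0 := by
  rw [Algebra.algebraMap_eq_smul_one, map_smul, h.map_one, smul_zero]

theorem anticommutator (hδ : IsSkewDerivation σ δ) (hε : IsSkewDerivation σ ε)
    (hσ : ∀ a, σ (σ a) = a) (hδσ : ∀ a, δ (σ a) = -σ (δ a)) (hεσ : ∀ a, ε (σ a) = -σ (ε a)) :
    IsSkewDerivation (AlgHom.id R A) (δ ∘ₗ ε + ε ∘ₗ δ) := fun a b ↦ by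
  simp only [LinearMap.add_apply, LinearMap.comp_apply, hδ _ _, hε _ _, map_add, hσ, hδσ, hεσ,
    AlgHom.id_apply]
  noncomm_ring

theorem rTensor (h : IsSkewDerivation (AlgHom.id R A) δ) :
    IsSkewDerivation (AlgHom.id R (A ⊗[R] B)) (δ.rTensor B) := fun x y ↦ by
  induction x using TensorProduct.induction_on with
  | zero => simp
  | add x x' hx hx' => simp only [add_mul, map_add, hx, hx', AlgHom.id_apply]; abel
  | tmul a b =>
    induction y using TensorProduct.induction_on with
    | zero => simp
    | add y y' hy hy' => simp only [mul_add, map_add, hy, hy']; abel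
    | tmul a' b' =>
      simp [Algebra.TensorProduct.tmul_mul_tmul, h a a', TensorProduct.add_tmul]

theorem lTensor (h : IsSkewDerivation σ δ) :
    IsSkewDerivation (Algebra.TensorProduct.map (AlgHom.id R B) σ) (δ.lTensor B) := fun x y ↦ by
  induction x using TensorProduct.induction_on with
  | zero => simp
  | add x x' hx hx' => simp only [add_mul, map_add, hx, hx']; abel
  | tmul b a =>
    induction y using TensorProduct.induction_on with
    | zero => simp
    | add y y' hy hy' => simp only [mul_add, map_add, hy, hy']; abel
    | tmul b' a' =>
      simp [Algebra.TensorProduct.tmul_mul_tmul, h a a', TensorProduct.tmul_add]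

theorem conj {σ' : B →ₐ[R] B} (h : IsSkewDerivation σ δ) (e : A ≃ₐ[R] B)
    (hσ : ∀ a, e (σ a) = σ' (e a)) : IsSkewDerivation σ' (e.toLinearEquiv.conj δ) := fun a b ↦ by
  simp [LinearEquiv.conj_apply, h _ _, hσ]

end IsSkewDerivation

section TensorProduct

theorem tmul_one_mul {A : Type*} [CommRing A] [Algebra R A] (a : A) (x : A ⊗[R] B) :
    a ⊗ₜ 1 * x = x * a ⊗ₜ 1 := by
  induction x using TensorProduct.induction_on with
  | zero => rw [mul_zero, zero_mul]
  | add x y hx hy => rw [mul_add, add_mul, hx, hy]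
  | tmul a' b => simp only [Algebra.TensorProduct.tmul_mul_tmul, mul_comm, one_mul, mul_one]

variable {σ : B →ₐ[R] B}

theorem one_tmul_mul {b : B} (hb : ∀ b', b * b' = σ b' * b) (x : A ⊗[R] B) :
    1 ⊗ₜ b * x = Algebra.TensorProduct.map (AlgHom.id R A) σ x * 1 ⊗ₜ b := by
  induction x using TensorProduct.induction_on with
  | zero => rw [mul_zero, map_zero, zero_mul]
  | add x y hx hy => rw [mul_add, map_add, add_mul, hx, hy]
  | tmul a b' =>
    simp only [Algebra.TensorProduct.tmul_mul_tmul, Algebra.TensorProduct.map_tmul, hb, one_mul,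
      mul_one, AlgHom.id_apply]

theorem rTensor_map_id (δ : A →ₗ[R] A) (x : A ⊗[R] B) :
    δ.rTensor B (Algebra.TensorProduct.map (AlgHom.id R A) σ x) =
      Algebra.TensorProduct.map (AlgHom.id R A) σ (δ.rTensor B x) := by
  induction x using TensorProduct.induction_on with
  | zero => simp only [map_zero]
  | add x y hx hy => simp only [map_add, hx, hy]
  | tmul a b => rfl

theorem lTensor_map_id {δ : B →ₗ[R] B} (h : ∀ b, δ (σ b) = -σ (δ b)) (x : A ⊗[R] B) :
    δ.lTensor A (Algebra.TensorProduct.map (AlgHom.id R A) σ x) =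
      -Algebra.TensorProduct.map (AlgHom.id R A) σ (δ.lTensor A x) := by
  induction x using TensorProduct.induction_on with
  | zero => simp only [map_zero, neg_zero]
  | add x y hx hy => simp only [map_add, hx, hy, neg_add]
  | tmul a b =>
    simp only [Algebra.TensorProduct.map_tmul, LinearMap.lTensor_tmul, h, TensorProduct.tmul_neg,
      AlgHom.id_apply]

end TensorProduct

section SumMulLeft

variable {ι : Type*} [Fintype ι] {σ : A →ₐ[R] A} {g : ι → A} {δ : ι → A →ₗ[R] A}

/-- The operator `∑ᵢ gᵢ δᵢ`, in which `gᵢ` acts by left multiplication. -/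
def sumMulLeft (g : ι → A) (δ : ι → A →ₗ[R] A) : A →ₗ[R] A :=
  ∑ i, LinearMap.mulLeft R (g i) ∘ₗ δ i

theorem sumMulLeft_apply (a : A) : sumMulLeft g δ a = ∑ i, g i * δ i a := by
  simp only [sumMulLeft, LinearMap.sum_apply, LinearMap.comp_apply, LinearMap.mulLeft_apply]

theorem IsSkewDerivation.sumMulLeft {τ : A →ₐ[R] A} (hδ : ∀ i, IsSkewDerivation σ (δ i))
    (hg : ∀ i a, g i * a = τ a * g i) : IsSkewDerivation (τ.comp σ) (sumMulLeft g δ) :=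
  fun a b ↦ by
    simp only [sumMulLeft_apply, hδ _ a b, mul_add, ← mul_assoc, hg _ (σ a),
      Finset.sum_add_distrib, Finset.sum_mul, Finset.mul_sum, AlgHom.comp_apply]

theorem sumMulLeft_map_of_commute (hg : ∀ i, σ (g i) = -g i) (hδ : ∀ i a, δ i (σ a) = σ (δ i a))
    (a : A) : sumMulLeft g δ (σ a) = -σ (sumMulLeft g δ a) := by
  simp only [sumMulLeft_apply, map_sum, map_mul, hg, hδ, neg_mul, Finset.sum_neg_distrib, neg_neg]

theorem sumMulLeft_map_of_anticommute (hg : ∀ i, σ (g i) = g i)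
    (hδ : ∀ i a, δ i (σ a) = -σ (δ i a)) (a : A) :
    sumMulLeft g δ (σ a) = -σ (sumMulLeft g δ a) := by
  simp only [sumMulLeft_apply, map_sum, map_mul, hg, hδ, mul_neg, Finset.sum_neg_distrib]

theorem sumMulLeft_eq_map_sum {X : Type*} [AddCommGroup X] [Module R X] (f : X →ₗ[R] A)
    {x : ι → X} {c : ι → R} {a : A} (h : ∀ i, δ i a = algebraMap R A (c i)) :
    sumMulLeft (fun i ↦ f (x i)) δ a = f (∑ i, c i • x i) := by
  simp only [sumMulLeft_apply, h, map_sum, map_smul, Algebra.smul_def, Algebra.commutes]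

theorem sumMulLeft_eq_zero {a : A} (h : ∀ i, δ i a = 0) : sumMulLeft g δ a = 0 := by
  simp only [sumMulLeft_apply, h, mul_zero, Finset.sum_const_zero]

end SumMulLeft

end SkewDerivation

section SymmetricAlgebra

variable {R V : Type*} [CommRing R] [AddCommGroup V] [Module R V]

/-- The algebra morphism `a ↦ a + ε ∂a` to the dual numbers over the symmetric algebra, where `∂` is
the directional derivative along a linear functional. -/
def symmetricDual (f : Module.Dual R V) :
    SymmetricAlgebra R V →ₐ[R] TrivSqZeroExt (SymmetricAlgebra R V) (SymmetricAlgebra R V) :=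
  SymmetricAlgebra.lift
    ((TrivSqZeroExt.inlAlgHom R (SymmetricAlgebra R V) (SymmetricAlgebra R V)).toLinearMap ∘ₗ
        SymmetricAlgebra.ι R V +
      (TrivSqZeroExt.inrHom (SymmetricAlgebra R V) (SymmetricAlgebra R V)).restrictScalars R ∘ₗ
        Algebra.linearMap R (SymmetricAlgebra R V) ∘ₗ f)

theorem fst_symmetricDual (f : Module.Dual R V) (a : SymmetricAlgebra R V) :
    (symmetricDual f a).fst = a := by
  have h : (TrivSqZeroExt.fstHom R (SymmetricAlgebra R V) (SymmetricAlgebra R V)).comp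
      (symmetricDual f) = AlgHom.id R _ :=
    SymmetricAlgebra.algHom_ext (by ext v; simp [symmetricDual])
  exact DFunLike.congr_fun h a

/-- The derivation of the symmetric algebra extending a linear functional on the generators. -/
def symmetricContract (f : Module.Dual R V) : SymmetricAlgebra R V →ₗ[R] SymmetricAlgebra R V :=
  (TrivSqZeroExt.sndHom (SymmetricAlgebra R V) (SymmetricAlgebra R V)).restrictScalars R ∘ₗ
    (symmetricDual f).toLinearMap

theorem symmetricContract_ι (f : Module.Dual R V) (v : V) :
    symmetricContract f (SymmetricAlgebra.ι R V v) = algebraMap R _ (f v) := by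
  simp [symmetricContract, symmetricDual, Algebra.algebraMap_eq_smul_one]

theorem isSkewDerivation_symmetricContract (f : Module.Dual R V) :
    IsSkewDerivation (AlgHom.id R _) (symmetricContract f) := fun a b ↦ by
  simp only [symmetricContract, LinearMap.comp_apply, AlgHom.toLinearMap_apply, map_mul,
    LinearMap.restrictScalars_apply, TrivSqZeroExt.sndHom_apply, TrivSqZeroExt.snd_mul,
    fst_symmetricDual, smul_eq_mul, MulOpposite.smul_eq_mul_unop, MulOpposite.unop_op,
    AlgHom.id_apply]
  ring

end SymmetricAlgebra

section ExteriorAlgebra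

open CliffordAlgebra

variable {R W : Type*} [CommRing R] [AddCommGroup W] [Module R W]

theorem isSkewDerivation_contractLeft {Q : QuadraticForm R W} (f : Module.Dual R W) :
    IsSkewDerivation involute (contractLeft (Q := Q) f) := fun a b ↦ by
  induction a using CliffordAlgebra.left_induction with
  | algebraMap r => simp [contractLeft_algebraMap, contractLeft_algebraMap_mul]
  | add x y hx hy => simp only [add_mul, map_add, hx, hy]; abel
  | ι_mul x w hx =>
    simp only [mul_assoc, contractLeft_ι_mul, hx, map_mul, involute_ι, sub_mul, mul_add,
      smul_mul_assoc, neg_mul]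
    abel

theorem contractLeft_involute {Q : QuadraticForm R W} (f : Module.Dual R W)
    (a : CliffordAlgebra Q) : contractLeft f (involute a) = -involute (contractLeft f a) := by
  induction a using CliffordAlgebra.left_induction with
  | algebraMap r => rw [AlgHom.commutes, contractLeft_algebraMap, map_zero, neg_zero]
  | add x y hx hy => rw [map_add, map_add, hx, hy, map_add, map_add, neg_add]
  | ι_mul x w hx =>
    rw [map_mul, involute_ι, neg_mul, map_neg, contractLeft_ι_mul, hx, contractLeft_ι_mul, map_sub,
      map_smul, map_mul, involute_ι, mul_neg, neg_mul]

theorem ι_mul_eq_involute_mul_ι (w : W) (a : ExteriorAlgebra R W) :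
    ExteriorAlgebra.ι R w * a = involute a * ExteriorAlgebra.ι R w := by
  induction a using CliffordAlgebra.left_induction with
  | algebraMap r => rw [AlgHom.commutes]; exact (Algebra.commutes r _).symm
  | add x y hx hy => simp only [add_mul, map_add, mul_add, hx, hy]
  | ι_mul x v hx =>
    have swap : ExteriorAlgebra.ι R w * ι 0 v = -(ι 0 v * ExteriorAlgebra.ι R w) :=
      eq_neg_of_add_eq_zero_left (ExteriorAlgebra.ι_add_mul_swap w v)
    rw [← mul_assoc, swap, neg_mul, mul_assoc, hx, map_mul, involute_ι, neg_mul, neg_mul,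
      mul_assoc]

end ExteriorAlgebra

section SuperSymmetricAlgebra

variable (R V W : Type*) [CommRing R] [AddCommGroup V] [Module R V] [AddCommGroup W] [Module R W]

/-- The free supercommutative algebra on even generators `V` and odd generators `W`. -/
def SuperSymmetricAlgebra : Type _ := SymmetricAlgebra R V ⊗[R] ExteriorAlgebra R W

namespace SuperSymmetricAlgebra

instance : Ring (SuperSymmetricAlgebra R V W) :=
  inferInstanceAs (Ring (SymmetricAlgebra R V ⊗[R] ExteriorAlgebra R W))

instance : Algebra R (SuperSymmetricAlgebra R V W) :=
  inferInstanceAs (Algebra R (SymmetricAlgebra R V ⊗[R] ExteriorAlgebra R W))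

/-- The automorphism that is `1` on even elements and `-1` on odd ones. -/
def parity : SuperSymmetricAlgebra R V W →ₐ[R] SuperSymmetricAlgebra R V W :=
  (Algebra.TensorProduct.map (AlgHom.id R _) CliffordAlgebra.involute :
    SymmetricAlgebra R V ⊗[R] ExteriorAlgebra R W →ₐ[R] _)

variable {R V}

/-- The elements of `V` as even generators. -/
def even : V →ₗ[R] SuperSymmetricAlgebra R V W :=
  (Algebra.TensorProduct.includeLeft :
    _ →ₐ[R] SymmetricAlgebra R V ⊗[R] ExteriorAlgebra R W).toLinearMap ∘ₗ SymmetricAlgebra.ι R V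

/-- The even derivation extending a linear functional on the even generators. -/
def evenContract (f : Module.Dual R V) :
    SuperSymmetricAlgebra R V W →ₗ[R] SuperSymmetricAlgebra R V W :=
  ((symmetricContract f).rTensor _ : SymmetricAlgebra R V ⊗[R] ExteriorAlgebra R W →ₗ[R] _)

variable {W} (V)

/-- The elements of `W` as odd generators. -/
def odd : W →ₗ[R] SuperSymmetricAlgebra R V W :=
  (Algebra.TensorProduct.includeRight :
    _ →ₐ[R] SymmetricAlgebra R V ⊗[R] ExteriorAlgebra R W).toLinearMap ∘ₗ ExteriorAlgebra.ι R

/-- The odd derivation extending a linear functional on the odd generators. -/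
def oddContract (g : Module.Dual R W) :
    SuperSymmetricAlgebra R V W →ₗ[R] SuperSymmetricAlgebra R V W :=
  ((CliffordAlgebra.contractLeft g).lTensor _ :
    SymmetricAlgebra R V ⊗[R] ExteriorAlgebra R W →ₗ[R] _)

variable {V}

theorem odd_eq_tmul (w : W) :
    odd V w = (1 : SymmetricAlgebra R V) ⊗ₜ[R] ExteriorAlgebra.ι R w :=
  rfl

theorem even_eq_tmul (v : V) :
    even W v = SymmetricAlgebra.ι R V v ⊗ₜ[R] (1 : ExteriorAlgebra R W) :=
  rfl

theorem parity_parity (a : SuperSymmetricAlgebra R V W) : parity R V W (parity R V W a) = a := by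
  have h : (parity R V W).comp (parity R V W) = AlgHom.id R _ :=
    (Algebra.TensorProduct.map_comp _ _ _ _).symm.trans <| by
      rw [AlgHom.comp_id, CliffordAlgebra.involute_comp_involute, Algebra.TensorProduct.map_id]
      rfl
  exact DFunLike.congr_fun h a

theorem parity_even (v : V) : parity R V W (even W v) = even W v :=
  congrArg (SymmetricAlgebra.ι R V v ⊗ₜ[R] ·) (CliffordAlgebra.involute (Q := 0)).map_one

theorem parity_odd (w : W) : parity R V W (odd V w) = -odd V w :=
  (congrArg ((1 : SymmetricAlgebra R V) ⊗ₜ[R] ·) (CliffordAlgebra.involute_ι w)).trans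
    (TensorProduct.tmul_neg _ _)

theorem even_mul (v : V) (a : SuperSymmetricAlgebra R V W) : even W v * a = a * even W v :=
  tmul_one_mul (SymmetricAlgebra.ι R V v) a

theorem odd_mul (w : W) (a : SuperSymmetricAlgebra R V W) :
    odd V w * a = parity R V W a * odd V w :=
  one_tmul_mul (ι_mul_eq_involute_mul_ι w) a

theorem isSkewDerivation_evenContract (f : Module.Dual R V) :
    IsSkewDerivation (AlgHom.id R _) (evenContract W f) :=
  (isSkewDerivation_symmetricContract f).rTensor

theorem isSkewDerivation_oddContract (g : Module.Dual R W) :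
    IsSkewDerivation (parity R V W) (oddContract V g) :=
  (isSkewDerivation_contractLeft g).lTensor

theorem evenContract_even (f : Module.Dual R V) (v : V) :
    evenContract W f (even W v) = algebraMap R _ (f v) :=
  congrArg (· ⊗ₜ[R] (1 : ExteriorAlgebra R W)) (symmetricContract_ι f v)

theorem evenContract_odd (f : Module.Dual R V) (w : W) : evenContract W f (odd V w) = 0 :=
  (congrArg (· ⊗ₜ[R] ExteriorAlgebra.ι R w)
    (isSkewDerivation_symmetricContract f).map_one).trans (TensorProduct.zero_tmul _ _)

theorem oddContract_even (g : Module.Dual R W) (v : V) : oddContract V g (even W v) = 0 :=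
  (congrArg (SymmetricAlgebra.ι R V v ⊗ₜ[R] ·) (CliffordAlgebra.contractLeft_one _ g)).trans
    (TensorProduct.tmul_zero _ _)

theorem oddContract_odd (g : Module.Dual R W) (w : W) :
    oddContract V g (odd V w) = algebraMap R _ (g w) :=
  (congrArg ((1 : SymmetricAlgebra R V) ⊗ₜ[R] ·) (CliffordAlgebra.contractLeft_ι _ _ w)).trans
    (Algebra.TensorProduct.algebraMap_apply' _).symm

theorem evenContract_parity (f : Module.Dual R V) (a : SuperSymmetricAlgebra R V W) :
    evenContract W f (parity R V W a) = parity R V W (evenContract W f a) :=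
  rTensor_map_id _ _

theorem oddContract_parity (g : Module.Dual R W) (a : SuperSymmetricAlgebra R V W) :
    oddContract V g (parity R V W a) = -parity R V W (oddContract V g a) :=
  lTensor_map_id (contractLeft_involute g) _

section Koszul

variable {ι : Type*} [Fintype ι] (f : ι → Module.Dual R V) (g : ι → Module.Dual R W)
  (v : ι → V) (w : ι → W)

/-- The Koszul differential `∑ᵢ wᵢ ∂/∂fᵢ`, which turns even generators into odd ones. -/
def koszul : SuperSymmetricAlgebra R V W →ₗ[R] SuperSymmetricAlgebra R V W :=
  sumMulLeft (fun i ↦ odd V (w i)) fun i ↦ evenContract W (f i)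

/-- The adjoint Koszul differential `∑ᵢ vᵢ ∂/∂gᵢ`, which turns odd generators into even ones. -/
def coKoszul : SuperSymmetricAlgebra R V W →ₗ[R] SuperSymmetricAlgebra R V W :=
  sumMulLeft (fun i ↦ even W (v i)) fun i ↦ oddContract V (g i)

/-- The anticommutator of the two Koszul differentials. -/
def laplacian : SuperSymmetricAlgebra R V W →ₗ[R] SuperSymmetricAlgebra R V W :=
  koszul f w ∘ₗ coKoszul g v + coKoszul g v ∘ₗ koszul f w

theorem isSkewDerivation_koszul : IsSkewDerivation (parity R V W) (koszul f w) :=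
  .sumMulLeft (fun i ↦ isSkewDerivation_evenContract (f i)) fun i ↦ odd_mul (w i)

theorem isSkewDerivation_coKoszul : IsSkewDerivation (parity R V W) (coKoszul g v) :=
  .sumMulLeft (τ := AlgHom.id R _) (fun i ↦ isSkewDerivation_oddContract (g i))
    fun i ↦ even_mul (v i)

theorem isSkewDerivation_laplacian : IsSkewDerivation (AlgHom.id R _) (laplacian f g v w) :=
  (isSkewDerivation_koszul f w).anticommutator (isSkewDerivation_coKoszul g v) parity_parity
    (sumMulLeft_map_of_commute (fun i ↦ parity_odd (w i)) fun i ↦ evenContract_parity (f i))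
    (sumMulLeft_map_of_anticommute (fun i ↦ parity_even (v i)) fun i ↦ oddContract_parity (g i))

theorem koszul_even (x : V) : koszul f w (even W x) = odd V (∑ i, f i x • w i) :=
  sumMulLeft_eq_map_sum (odd V) fun i ↦ evenContract_even (f i) x

theorem koszul_odd (y : W) : koszul f w (odd V y) = 0 :=
  sumMulLeft_eq_zero fun i ↦ evenContract_odd (f i) y

theorem coKoszul_even (x : V) : coKoszul g v (even W x) = 0 :=
  sumMulLeft_eq_zero fun i ↦ oddContract_even (g i) x

theorem coKoszul_odd (y : W) : coKoszul g v (odd V y) = even W (∑ i, g i y • v i) :=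
  sumMulLeft_eq_map_sum (even W) fun i ↦ oddContract_odd (g i) y

end Koszul

end SuperSymmetricAlgebra

end SuperSymmetricAlgebra

/-! ### Koszul differentials on the fibre algebra -/

section Fibre

variable {T : Type*} [AddCommGroup T] [Module ℂ T] [TopologicalSpace T]
  {r : ℕ} {G : Fin r → Type*} [∀ k, AddCommGroup (G k)] [∀ k, Module ℂ (G k)]
  [∀ k, TopologicalSpace (G k)]

open SuperSymmetricAlgebra

instance : AddCommGroup (EvenGen T G) := inferInstance
instance : Module ℂ (EvenGen T G) := inferInstance
instance : AddCommGroup (OddGen T G) := inferInstance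
instance : Module ℂ (OddGen T G) := inferInstance

variable (T G) in
/-- The identification of the fibre algebra, whose ring structure is only given through its
underlying tensor product, with a free supercommutative algebra. -/
def fibreEquiv : SuperSymmetricAlgebra ℂ (EvenGen T G) (OddGen T G) ≃ₐ[ℂ] FibreAlg T G where
  toFun a := a
  invFun a := a
  left_inv _ := rfl
  right_inv _ := rfl
  map_mul' _ _ := rfl
  map_add' _ _ := rfl
  commutes' _ := rfl

variable (G) in
theorem fibreEquiv_symm_formGen (α : T →L[ℂ] ℂ) :
    (fibreEquiv T G).symm (formGen G α) = odd (EvenGen T G) ((α, 0) : OddGen T G) :=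
  (odd_eq_tmul (V := EvenGen T G) _).symm

variable (G) in
theorem fibreEquiv_symm_symGen (α : T →L[ℂ] ℂ) :
    (fibreEquiv T G).symm (symGen G α) = even (OddGen T G) ((α, 0) : EvenGen T G) :=
  (even_eq_tmul (W := OddGen T G) _).symm

variable (T) in
theorem exists_fibreEquiv_symm_wGen_eq_even {k : Fin r} (hk : Odd (k : ℕ)) (β : G k →L[ℂ] ℂ) :
    ∃ γ, (fibreEquiv T G).symm (wGen T k β) = even (OddGen T G) ((0, γ) : EvenGen T G) :=
  ⟨_, (congrArg (fibreEquiv T G).symm (dif_pos hk)).trans (even_eq_tmul (W := OddGen T G) _).symm⟩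

variable (T) in
theorem exists_fibreEquiv_symm_wGen_eq_odd {k : Fin r} (hk : Even (k : ℕ)) (β : G k →L[ℂ] ℂ) :
    ∃ γ, (fibreEquiv T G).symm (wGen T k β) = odd (EvenGen T G) ((0, γ) : OddGen T G) :=
  ⟨_, (congrArg (fibreEquiv T G).symm (dif_neg (Nat.not_odd_iff_even.2 hk))).trans
    (odd_eq_tmul (V := EvenGen T G) _).symm⟩

theorem fibreEquiv_odd (α : T →L[ℂ] ℂ) :
    fibreEquiv T G (odd (EvenGen T G) ((α, 0) : OddGen T G)) = formGen G α :=
  (AlgEquiv.eq_symm_apply _).1 (fibreEquiv_symm_formGen G α).symm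

theorem fibreEquiv_even (α : T →L[ℂ] ℂ) :
    fibreEquiv T G (even (OddGen T G) ((α, 0) : EvenGen T G)) = symGen G α :=
  (AlgEquiv.eq_symm_apply _).1 (fibreEquiv_symm_symGen G α).symm

variable (T G) in
/-- The automorphism `(-1)^(total degree)` of the fibre algebra. -/
def fibreParity : FibreAlg T G →ₐ[ℂ] FibreAlg T G :=
  (fibreEquiv T G).toAlgHom.comp ((parity ℂ _ _).comp (fibreEquiv T G).symm.toAlgHom)

theorem fibreParity_apply (a : FibreAlg T G) :
    fibreParity T G a = fibreEquiv T G (parity ℂ _ _ ((fibreEquiv T G).symm a)) :=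
  rfl

theorem fibreParity_formGen (α : T →L[ℂ] ℂ) : fibreParity T G (formGen G α) = -formGen G α := by
  rw [fibreParity_apply, fibreEquiv_symm_formGen, parity_odd, map_neg, fibreEquiv_odd]

theorem fibreParity_symGen (α : T →L[ℂ] ℂ) : fibreParity T G (symGen G α) = symGen G α := by
  rw [fibreParity_apply, fibreEquiv_symm_symGen, parity_even, fibreEquiv_even]

theorem fibreParity_wGen (k : Fin r) (β : G k →L[ℂ] ℂ) :
    fibreParity T G (wGen T k β) = (-1 : ℂ) ^ ((k : ℕ) + 1) • wGen T k β := by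
  rw [fibreParity_apply, ← AlgEquiv.eq_symm_apply, map_smul]
  rcases Nat.even_or_odd (k : ℕ) with hk | hk
  · obtain ⟨γ, hγ⟩ := exists_fibreEquiv_symm_wGen_eq_odd T hk β
    rw [hγ, parity_odd, hk.add_one.neg_one_pow, neg_one_smul]
  · obtain ⟨γ, hγ⟩ := exists_fibreEquiv_symm_wGen_eq_even T hk β
    rw [hγ, parity_even, hk.add_one.neg_one_pow, one_smul]

/-- Evaluation at `v` of the covector component of a generator. -/
def evalCovector (X : Type*) [AddCommGroup X] [Module ℂ X] (v : T) :
    Module.Dual ℂ ((T →L[ℂ] ℂ) × X) where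
  toFun a := a.1 v
  map_add' _ _ := rfl
  map_smul' _ _ := rfl

theorem evalCovector_mk {X : Type*} [AddCommGroup X] [Module ℂ X] (v : T) (α : T →L[ℂ] ℂ)
    (x : X) : evalCovector X v (α, x) = α v :=
  rfl

/-- The contraction of symmetric generators with a tangent vector. -/
def symContract (v : T) : FibreAlg T G →ₗ[ℂ] FibreAlg T G :=
  (fibreEquiv T G).toLinearEquiv.conj (evenContract (OddGen T G) (evalCovector _ v))

theorem symContract_apply (v : T) (a : FibreAlg T G) :
    symContract v a =
      fibreEquiv T G (evenContract _ (evalCovector _ v) ((fibreEquiv T G).symm a)) :=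
  rfl

theorem isSkewDerivation_symContract (v : T) :
    IsSkewDerivation (AlgHom.id ℂ (FibreAlg T G)) (symContract v) :=
  (isSkewDerivation_evenContract _).conj (fibreEquiv T G) fun _ ↦ rfl

theorem symContract_symGen (v : T) (α : T →L[ℂ] ℂ) :
    symContract v (symGen G α) = algebraMap ℂ _ (α v) := by
  rw [symContract_apply, fibreEquiv_symm_symGen, evenContract_even, evalCovector_mk,
    AlgEquiv.commutes]

theorem symContract_formGen (v : T) (α : T →L[ℂ] ℂ) : symContract v (formGen G α) = 0 := by
  rw [symContract_apply, fibreEquiv_symm_formGen, evenContract_odd, map_zero]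

theorem symContract_wGen (v : T) (k : Fin r) (β : G k →L[ℂ] ℂ) :
    symContract v (wGen T k β) = 0 := by
  rw [symContract_apply]
  rcases Nat.even_or_odd (k : ℕ) with hk | hk
  · obtain ⟨γ, hγ⟩ := exists_fibreEquiv_symm_wGen_eq_odd T hk β
    rw [hγ, evenContract_odd, map_zero]
  · obtain ⟨γ, hγ⟩ := exists_fibreEquiv_symm_wGen_eq_even T hk β
    rw [hγ, evenContract_even, evalCovector_mk, zero_apply, map_zero, map_zero]

theorem symGen_mul (α : T →L[ℂ] ℂ) (a : FibreAlg T G) : symGen G α * a = a * symGen G α := by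
  apply (fibreEquiv T G).symm.injective
  rw [map_mul, map_mul, fibreEquiv_symm_symGen, even_mul]

variable {ι : Type*} [Fintype ι]

/-- Every covector is expanded in `z` with its values on `e` as coefficients, as for a basis `e` and
its dual basis `z`; neither family need be linearly independent. -/
def IsDualFrame (e : ι → T) (z : ι → T →L[ℂ] ℂ) : Prop :=
  ∀ α : T →L[ℂ] ℂ, ∑ i, α (e i) • z i = α

section Operators

variable (e : ι → T) (z : ι → T →L[ℂ] ℂ)

/-- The Euler derivation of the symmetric generators. -/
def fibreEuler : FibreAlg T G →ₗ[ℂ] FibreAlg T G :=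
  sumMulLeft (fun i ↦ symGen G (z i)) fun i ↦ symContract (e i)

/-- The Koszul differential of the fibre algebra, which turns symmetric generators into forms. -/
def fibreKoszul : FibreAlg T G →ₗ[ℂ] FibreAlg T G :=
  (fibreEquiv T G).toLinearEquiv.conj
    (koszul (W := OddGen T G) (fun i ↦ evalCovector _ (e i)) fun i ↦ (z i, 0))

/-- The adjoint Koszul differential, which turns forms into symmetric generators. -/
def fibreCoKoszul : FibreAlg T G →ₗ[ℂ] FibreAlg T G :=
  (fibreEquiv T G).toLinearEquiv.conj
    (coKoszul (V := EvenGen T G) (fun i ↦ evalCovector _ (e i)) fun i ↦ (z i, 0))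

/-- The anticommutator of the two Koszul differentials. -/
def fibreLaplacian : FibreAlg T G →ₗ[ℂ] FibreAlg T G :=
  fibreKoszul e z ∘ₗ fibreCoKoszul e z + fibreCoKoszul e z ∘ₗ fibreKoszul e z

theorem fibreKoszul_apply (a : FibreAlg T G) :
    fibreKoszul e z a =
      fibreEquiv T G (koszul (fun i ↦ evalCovector _ (e i)) (fun i ↦ (z i, 0))
        ((fibreEquiv T G).symm a)) :=
  rfl

theorem fibreCoKoszul_apply (a : FibreAlg T G) :
    fibreCoKoszul e z a =
      fibreEquiv T G (coKoszul (fun i ↦ evalCovector _ (e i)) (fun i ↦ (z i, 0))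
        ((fibreEquiv T G).symm a)) :=
  rfl

theorem fibreLaplacian_apply (a : FibreAlg T G) :
    fibreLaplacian e z a =
      fibreKoszul e z (fibreCoKoszul e z a) + fibreCoKoszul e z (fibreKoszul e z a) :=
  rfl

theorem isSkewDerivation_fibreEuler :
    IsSkewDerivation (AlgHom.id ℂ (FibreAlg T G)) (fibreEuler e z) :=
  .sumMulLeft (τ := AlgHom.id ℂ _) (fun i ↦ isSkewDerivation_symContract (e i))
    fun i ↦ symGen_mul (z i)

theorem isSkewDerivation_fibreKoszul :
    IsSkewDerivation (fibreParity T G) (fibreKoszul e z) :=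
  (isSkewDerivation_koszul _ _).conj (fibreEquiv T G) fun _ ↦ rfl

theorem isSkewDerivation_fibreCoKoszul :
    IsSkewDerivation (fibreParity T G) (fibreCoKoszul e z) :=
  (isSkewDerivation_coKoszul _ _).conj (fibreEquiv T G) fun _ ↦ rfl

theorem isSkewDerivation_fibreLaplacian :
    IsSkewDerivation (AlgHom.id ℂ (FibreAlg T G)) (fibreLaplacian e z) := by
  have h := (isSkewDerivation_laplacian (V := EvenGen T G) (W := OddGen T G)
    (fun i ↦ evalCovector _ (e i)) (fun i ↦ evalCovector _ (e i)) (fun i ↦ (z i, 0))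
    fun i ↦ (z i, 0)).conj (σ' := AlgHom.id ℂ _) (fibreEquiv T G) fun _ ↦ rfl
  rwa [laplacian, map_add, LinearEquiv.conj_comp, LinearEquiv.conj_comp] at h

theorem fibreKoszul_formGen (α : T →L[ℂ] ℂ) : fibreKoszul e z (formGen G α) = 0 := by
  rw [fibreKoszul_apply, fibreEquiv_symm_formGen, koszul_odd, map_zero]

theorem fibreCoKoszul_symGen (α : T →L[ℂ] ℂ) : fibreCoKoszul e z (symGen G α) = 0 := by
  rw [fibreCoKoszul_apply, fibreEquiv_symm_symGen, coKoszul_even, map_zero]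

theorem fibreEuler_formGen (α : T →L[ℂ] ℂ) : fibreEuler e z (formGen G α) = 0 :=
  sumMulLeft_eq_zero fun i ↦ symContract_formGen (e i) α

theorem fibreEuler_wGen (k : Fin r) (β : G k →L[ℂ] ℂ) : fibreEuler e z (wGen T k β) = 0 :=
  sumMulLeft_eq_zero fun i ↦ symContract_wGen (e i) k β

theorem fibreKoszul_wGen (k : Fin r) (β : G k →L[ℂ] ℂ) : fibreKoszul e z (wGen T k β) = 0 := by
  rw [fibreKoszul_apply]
  rcases Nat.even_or_odd (k : ℕ) with hk | hk
  · obtain ⟨γ, hγ⟩ := exists_fibreEquiv_symm_wGen_eq_odd T hk β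
    rw [hγ, koszul_odd, map_zero]
  · obtain ⟨γ, hγ⟩ := exists_fibreEquiv_symm_wGen_eq_even T hk β
    rw [hγ, koszul, sumMulLeft_eq_zero fun i ↦ (evenContract_even _ _).trans (map_zero _), map_zero]

theorem fibreCoKoszul_wGen (k : Fin r) (β : G k →L[ℂ] ℂ) :
    fibreCoKoszul e z (wGen T k β) = 0 := by
  rw [fibreCoKoszul_apply]
  rcases Nat.even_or_odd (k : ℕ) with hk | hk
  · obtain ⟨γ, hγ⟩ := exists_fibreEquiv_symm_wGen_eq_odd T hk β
    rw [hγ, coKoszul, sumMulLeft_eq_zero fun i ↦ (oddContract_odd _ _).trans (map_zero _), map_zero]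
  · obtain ⟨γ, hγ⟩ := exists_fibreEquiv_symm_wGen_eq_even T hk β
    rw [hγ, coKoszul_even, map_zero]

theorem fibreLaplacian_wGen (k : Fin r) (β : G k →L[ℂ] ℂ) :
    fibreLaplacian e z (wGen T k β) = 0 := by
  rw [fibreLaplacian_apply, fibreCoKoszul_wGen, fibreKoszul_wGen, map_zero, map_zero, add_zero]

end Operators

namespace IsDualFrame

variable {e : ι → T} {z : ι → T →L[ℂ] ℂ} (h : IsDualFrame e z)

include h

theorem sum_evalCovector_smul (X : Type*) [AddCommGroup X] [Module ℂ X] (α : T →L[ℂ] ℂ) :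
    ∑ i, evalCovector X (e i) (α, 0) • ((z i, 0) : (T →L[ℂ] ℂ) × X) = (α, 0) := by
  have hα := congrArg (LinearMap.inl ℂ (T →L[ℂ] ℂ) X) (h α)
  simpa only [map_sum, map_smul, LinearMap.inl_apply, evalCovector_mk] using hα

theorem fibreKoszul_symGen (α : T →L[ℂ] ℂ) : fibreKoszul e z (symGen G α) = formGen G α := by
  rw [fibreKoszul_apply, fibreEquiv_symm_symGen, koszul_even, ← fibreEquiv_odd]
  exact congrArg (fun w ↦ fibreEquiv T G (odd _ w)) (h.sum_evalCovector_smul _ α)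

theorem fibreCoKoszul_formGen (α : T →L[ℂ] ℂ) : fibreCoKoszul e z (formGen G α) = symGen G α := by
  rw [fibreCoKoszul_apply, fibreEquiv_symm_formGen, coKoszul_odd, ← fibreEquiv_even]
  exact congrArg (fun v ↦ fibreEquiv T G (even _ v)) (h.sum_evalCovector_smul _ α)

theorem fibreEuler_symGen (α : T →L[ℂ] ℂ) : fibreEuler e z (symGen G α) = symGen G α := by
  have hα := congrArg (fibreEquiv T G ∘ even _) (h.sum_evalCovector_smul _ α)
  simp only [Function.comp_apply, map_sum, map_smul, fibreEquiv_even, evalCovector_mk] at hα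
  rw [fibreEuler, sumMulLeft_apply, ← hα]
  exact Finset.sum_congr rfl fun i _ ↦ by
    rw [hα, symContract_symGen, ← Algebra.commutes, Algebra.smul_def]

theorem fibreLaplacian_formGen (α : T →L[ℂ] ℂ) :
    fibreLaplacian e z (formGen G α) = formGen G α := by
  rw [fibreLaplacian_apply, h.fibreCoKoszul_formGen, h.fibreKoszul_symGen, fibreKoszul_formGen,
    map_zero, add_zero]

theorem fibreLaplacian_symGen (α : T →L[ℂ] ℂ) :
    fibreLaplacian e z (symGen G α) = symGen G α := by
  rw [fibreLaplacian_apply, h.fibreKoszul_symGen, h.fibreCoKoszul_formGen, fibreCoKoszul_symGen,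
    map_zero, zero_add]

end IsDualFrame

end Fibre

/-! ### Homogeneous operators on polynomial sections -/

section Sections

variable {E : Type*} [NormedAddCommGroup E] [NormedSpace ℂ E]
  {M : Type*} [TopologicalSpace M] [ChartedSpace E M]
  {r : ℕ} {𝔤 : Fin r → M → Type*}
  [∀ k x, AddCommGroup (𝔤 k x)] [∀ k x, Module ℂ (𝔤 k x)] [∀ k x, TopologicalSpace (𝔤 k x)]
  [∀ k x, IsTopologicalAddGroup (𝔤 k x)] [∀ k x, ContinuousSMul ℂ (𝔤 k x)]

/-- The operator on arbitrary sections given by a linear operator on each fibre. -/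
def secOp (f : ∀ x : M, AlgAt E 𝔤 x →ₗ[ℂ] AlgAt E 𝔤 x) (U : Opens M) :
    Sec E 𝔤 U →ₗ[ℂ] Sec E 𝔤 U where
  toFun s x := f x (s x)
  map_add' s t := funext fun x ↦ map_add (f x) (s x) (t x)
  map_smul' c s := funext fun x ↦ map_smul (f x) c (s x)

theorem resSec_secOp (f : ∀ x : M, AlgAt E 𝔤 x →ₗ[ℂ] AlgAt E 𝔤 x) {U V : Opens M} (h : V ≤ U)
    (s : Sec E 𝔤 U) : resSec E 𝔤 h (secOp f U s) = secOp f V (resSec E 𝔤 h s) :=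
  rfl

theorem secOp_mul {σ : ∀ x : M, AlgAt E 𝔤 x →ₐ[ℂ] AlgAt E 𝔤 x}
    {f : ∀ x : M, AlgAt E 𝔤 x →ₗ[ℂ] AlgAt E 𝔤 x} {U : Opens M}
    (hf : ∀ x ∈ U, IsSkewDerivation (σ x) (f x)) (s t : Sec E 𝔤 U) :
    secOp f U (s * t) = secOp f U s * t + secOp (fun x ↦ (σ x).toLinearMap) U s * secOp f U t :=
  funext fun x ↦ hf x x.2 (s x) (t x)

theorem secOp_algHom_mul (σ : ∀ x : M, AlgAt E 𝔤 x →ₐ[ℂ] AlgAt E 𝔤 x) {U : Opens M}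
    (s t : Sec E 𝔤 U) :
    secOp (fun x ↦ (σ x).toLinearMap) U (s * t) =
      secOp (fun x ↦ (σ x).toLinearMap) U s * secOp (fun x ↦ (σ x).toLinearMap) U t :=
  funext fun x ↦ map_mul (σ x) (s x) (t x)

theorem secOp_apply_eq_smul {f : ∀ x : M, AlgAt E 𝔤 x →ₗ[ℂ] AlgAt E 𝔤 x} {U : Opens M}
    {s : Sec E 𝔤 U} {c : ℂ} (h : ∀ x : U, f x (s x) = c • s x) : secOp f U s = c • s :=
  funext h

theorem secOp_apply_eq_zero {f : ∀ x : M, AlgAt E 𝔤 x →ₗ[ℂ] AlgAt E 𝔤 x} {U : Opens M}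
    {s : Sec E 𝔤 U} (h : ∀ x : U, f x (s x) = 0) : secOp f U s = 0 :=
  funext h

variable [IsManifold 𝓘(ℂ, E) ω M]
  {F : Fin r → Type*} [∀ k, NormedAddCommGroup (F k)] [∀ k, NormedSpace ℂ (F k)]
  [∀ k, TopologicalSpace (TotalSpace (F k) (𝔤 k))]
  [∀ k, FiberBundle (F k) (𝔤 k)] [∀ k, VectorBundle ℂ (F k) (𝔤 k)]

theorem HolPoly.smul {V : Opens M} {m : Deg} {s : Sec E 𝔤 V} (c : ℂ)
    (hs : HolPoly E F 𝔤 V m s) : HolPoly E F 𝔤 V m (c • s) := by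
  have h := HolPoly.mul 0 m _ s (HolPoly.fn (E := E) (F := F) (𝔤 := 𝔤) (fun _ ↦ c)
    contMDiffOn_const) hs
  rw [zero_add] at h
  exact (funext fun x ↦ Algebra.smul_def c (s x) : c • s = _) ▸ h

theorem IsHol.smul {U : Opens M} {m : Deg} {s : Sec E 𝔤 U} (c : ℂ)
    (hs : IsHol E F 𝔤 U m s) : IsHol E F 𝔤 U m (c • s) := fun x hx ↦
  have ⟨V, hV, hxV, hp⟩ := hs x hx
  ⟨V, hV, hxV, hp.smul c⟩

theorem HolPoly.secOp_fibreParity {V : Opens M} {m : Deg} {s : Sec E 𝔤 V}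
    (hs : HolPoly E F 𝔤 V m s) :
    secOp (fun _ ↦ (fibreParity _ _).toLinearMap) V s = (-1 : ℂ) ^ (m 0 + m 2) • s := by
  induction hs with
  | zero m => rw [map_zero, smul_zero]
  | fn f _ =>
    refine (secOp_apply_eq_smul (c := 1) fun x ↦ ?_).trans (congrArg (· • _) (by simp))
    exact (AlgHom.commutes (fibreParity _ _) (f x)).trans (one_smul ℂ _).symm
  | form α _ =>
    refine (secOp_apply_eq_smul (c := -1) fun x ↦ ?_).trans (congrArg (· • _) (by simp))
    exact (fibreParity_formGen (α x)).trans (neg_one_smul ℂ (formGen _ (α x))).symm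
  | sym α _ =>
    refine (secOp_apply_eq_smul (c := 1) fun x ↦ ?_).trans (congrArg (· • _) (by simp))
    exact (fibreParity_symGen (α x)).trans (one_smul ℂ (symGen _ (α x))).symm
  | w k β _ =>
    refine (secOp_apply_eq_smul (c := (-1) ^ ((k : ℕ) + 1)) fun x ↦ ?_).trans
      (congrArg (· • _) (by simp))
    exact fibreParity_wGen (T := TangentSpace 𝓘(ℂ, E) (x : M)) (G := fun k ↦ 𝔤 k (x : M))
      k (β x)
  | add m s t _ _ hs ht => rw [map_add, hs, ht, smul_add]
  | mul m n s t _ _ hs ht =>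
    rw [secOp_algHom_mul, hs, ht, smul_mul_smul_comm, ← pow_add, Finsupp.add_apply,
      Finsupp.add_apply, add_add_add_comm]

/-- `s` is a section of multidegree `m - d₁ + d₂`, and it vanishes if there is no multidegree
`m - d₁`. -/
def IsShifted (E : Type*) [NormedAddCommGroup E] [NormedSpace ℂ E]
    {M : Type*} [TopologicalSpace M] [ChartedSpace E M] [IsManifold 𝓘(ℂ, E) ω M]
    {r : ℕ} (F : Fin r → Type*) [∀ k, NormedAddCommGroup (F k)] [∀ k, NormedSpace ℂ (F k)]
    (𝔤 : Fin r → M → Type*) [∀ k, TopologicalSpace (TotalSpace (F k) (𝔤 k))]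
    [∀ k x, AddCommGroup (𝔤 k x)] [∀ k x, Module ℂ (𝔤 k x)] [∀ k x, TopologicalSpace (𝔤 k x)]
    [∀ k x, IsTopologicalAddGroup (𝔤 k x)] [∀ k x, ContinuousSMul ℂ (𝔤 k x)]
    [∀ k, FiberBundle (F k) (𝔤 k)] [∀ k, VectorBundle ℂ (F k) (𝔤 k)]
    (d₁ d₂ : Deg) (V : Opens M) (m : Deg) (s : Sec E 𝔤 V) : Prop :=
  s = 0 ∨ ∃ m', m' + d₁ = m ∧ HolPoly E F 𝔤 V (m' + d₂) s

namespace IsShifted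

variable {d₁ d₂ m n : Deg} {V : Opens M} {s t : Sec E 𝔤 V}

theorem of_holPoly (h : HolPoly E F 𝔤 V d₂ s) : IsShifted E F 𝔤 d₁ d₂ V d₁ s :=
  .inr ⟨0, zero_add d₁, (zero_add d₂).symm ▸ h⟩

theorem add (hs : IsShifted E F 𝔤 d₁ d₂ V m s) (ht : IsShifted E F 𝔤 d₁ d₂ V m t) :
    IsShifted E F 𝔤 d₁ d₂ V m (s + t) := by
  rcases hs with rfl | ⟨p, hp, hs⟩
  · rwa [zero_add]
  rcases ht with rfl | ⟨q, hq, ht⟩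
  · exact .inr ⟨p, hp, (add_zero s).symm ▸ hs⟩
  obtain rfl := add_right_cancel (hp.trans hq.symm)
  exact .inr ⟨p, hp, .add _ _ _ hs ht⟩

theorem mul_holPoly (hs : IsShifted E F 𝔤 d₁ d₂ V m s) (ht : HolPoly E F 𝔤 V n t) :
    IsShifted E F 𝔤 d₁ d₂ V (m + n) (s * t) := by
  rcases hs with rfl | ⟨p, rfl, hs⟩
  · exact .inl (zero_mul t)
  · exact .inr ⟨p + n, add_right_comm p n d₁, add_right_comm p d₂ n ▸ .mul _ _ _ _ hs ht⟩

theorem holPoly_mul (hs : HolPoly E F 𝔤 V m s) (ht : IsShifted E F 𝔤 d₁ d₂ V n t) :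
    IsShifted E F 𝔤 d₁ d₂ V (m + n) (s * t) := by
  rcases ht with rfl | ⟨p, rfl, ht⟩
  · exact .inl (mul_zero s)
  · exact .inr ⟨m + p, add_assoc m p d₁, (add_assoc m p d₂).symm ▸ .mul _ _ _ _ hs ht⟩

theorem holPoly (hs : IsShifted E F 𝔤 d₁ d₂ V (m + d₁) s) : HolPoly E F 𝔤 V (m + d₂) s := by
  rcases hs with rfl | ⟨p, hp, hs⟩
  · exact .zero _
  · exact add_right_cancel hp ▸ hs

theorem eq_zero (hs : IsShifted E F 𝔤 d₁ d₂ V m s) (hm : ¬ d₁ ≤ m) : s = 0 :=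
  hs.resolve_right fun ⟨_, hp, _⟩ ↦ hm (hp ▸ self_le_add_left _ _)

end IsShifted

theorem HolPoly.isShifted {d₁ d₂ : Deg} {V : Opens M}
    {σ : ∀ x : M, AlgAt E 𝔤 x →ₐ[ℂ] AlgAt E 𝔤 x} {f : ∀ x : M, AlgAt E 𝔤 x →ₗ[ℂ] AlgAt E 𝔤 x}
    (hf : ∀ x ∈ V, IsSkewDerivation (σ x) (f x))
    (hσ : ∀ {m s}, HolPoly E F 𝔤 V m s →
      HolPoly E F 𝔤 V m (secOp (fun x ↦ (σ x).toLinearMap) V s))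
    (hform : ∀ α, IsHolDual E E V α → IsShifted E F 𝔤 d₁ d₂ V (.single 0 1)
      (secOp f V fun x ↦ formGen _ (α x)))
    (hsym : ∀ α, IsHolDual E E V α → IsShifted E F 𝔤 d₁ d₂ V (.single 1 1)
      (secOp f V fun x ↦ symGen _ (α x)))
    (hw : ∀ x ∈ V, ∀ (k : Fin r) (β : 𝔤 k x →L[ℂ] ℂ),
      f x (wGen (TangentSpace 𝓘(ℂ, E) x) (G := fun k ↦ 𝔤 k x) k β) = 0)
    {m : Deg} {s : Sec E 𝔤 V} (hs : HolPoly E F 𝔤 V m s) :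
    IsShifted E F 𝔤 d₁ d₂ V m (secOp f V s) := by
  induction hs with
  | zero m => exact .inl (map_zero _)
  | fn g _ => exact .inl (secOp_apply_eq_zero fun x ↦ (hf x x.2).map_algebraMap (g x))
  | form α hα => exact hform α hα
  | sym α hα => exact hsym α hα
  | w k β _ => exact .inl (secOp_apply_eq_zero fun x ↦ hw x x.2 k (β x))
  | add m s t _ _ hs ht => exact (map_add (secOp f V) s t).symm ▸ hs.add ht
  | mul m n s t hs ht ihs iht =>
    rw [secOp_mul hf]
    exact (ihs.mul_holPoly ht).add (.holPoly_mul (hσ hs) iht)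

theorem HolPoly.secOp_eq_smul {V : Opens M} {a b : ℂ}
    {f : ∀ x : M, AlgAt E 𝔤 x →ₗ[ℂ] AlgAt E 𝔤 x}
    (hf : ∀ x ∈ V, IsSkewDerivation (AlgHom.id ℂ (AlgAt E 𝔤 x)) (f x))
    (hform : ∀ x ∈ V, ∀ α : TangentSpace 𝓘(ℂ, E) x →L[ℂ] ℂ,
      f x (formGen _ α) = a • formGen _ α)
    (hsym : ∀ x ∈ V, ∀ α : TangentSpace 𝓘(ℂ, E) x →L[ℂ] ℂ, f x (symGen _ α) = b • symGen _ α)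
    (hw : ∀ x ∈ V, ∀ (k : Fin r) (β : 𝔤 k x →L[ℂ] ℂ),
      f x (wGen (TangentSpace 𝓘(ℂ, E) x) (G := fun k ↦ 𝔤 k x) k β) = 0)
    {m : Deg} {s : Sec E 𝔤 V} (hs : HolPoly E F 𝔤 V m s) :
    secOp f V s = (a * m 0 + b * m 1) • s := by
  induction hs with
  | zero m => rw [map_zero, smul_zero]
  | fn g _ =>
    refine (secOp_apply_eq_zero fun x ↦ (hf x x.2).map_algebraMap (g x)).trans ?_
    exact (zero_smul ℂ _).symm.trans (congrArg (· • _) (by simp))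
  | form α _ =>
    exact (secOp_apply_eq_smul fun x ↦ hform x x.2 (α x)).trans (congrArg (· • _) (by simp))
  | sym α _ =>
    exact (secOp_apply_eq_smul fun x ↦ hsym x x.2 (α x)).trans (congrArg (· • _) (by simp))
  | w k β _ =>
    refine (secOp_apply_eq_zero fun x ↦ hw x x.2 k (β x)).trans ?_
    exact (zero_smul ℂ _).symm.trans (congrArg (· • _) (by simp))
  | add m s t _ _ hs ht => rw [map_add, hs, ht, smul_add]
  | mul m n s t _ _ hs ht =>
    have hmul : secOp f V (s * t) = secOp f V s * t + s * secOp f V t := secOp_mul hf s t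
    rw [hmul, hs, ht, smul_mul_assoc, mul_smul_comm, ← add_smul, Finsupp.add_apply,
      Finsupp.add_apply]
    push_cast
    congr 1
    ring

end Sections

/-! ### Koszul differentials on sections -/

section Koszul

variable {E : Type*} [NormedAddCommGroup E] [NormedSpace ℂ E]
  {M : Type*} [TopologicalSpace M] [ChartedSpace E M]

section Frame

section

variable [IsManifold 𝓘(ℂ, E) ω M]

variable (E) in
/-- The domain of the local frame of the tangent bundle around `x₀`. -/
def frameDomain (x₀ : M) : Opens M :=
  ⟨(trivializationAt E (TangentSpace 𝓘(ℂ, E) : M → Type _) x₀).baseSet,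
    (trivializationAt E (TangentSpace 𝓘(ℂ, E) : M → Type _) x₀).open_baseSet⟩

theorem mem_frameDomain (x₀ : M) : x₀ ∈ frameDomain E x₀ :=
  mem_baseSet_trivializationAt E (TangentSpace 𝓘(ℂ, E) : M → Type _) x₀

end

variable [FiniteDimensional ℂ E]

/-- A frame of the tangent spaces, in general discontinuous; the Koszul differentials, which do not
depend on the frame, are globally defined by means of it. -/
def baseVec (i : Fin (Module.finrank ℂ E)) (x : M) : TangentSpace 𝓘(ℂ, E) x :=
  Module.finBasis ℂ E i

/-- The dual frame of `baseVec`. -/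
def baseCovec (i : Fin (Module.finrank ℂ E)) (x : M) : TangentSpace 𝓘(ℂ, E) x →L[ℂ] ℂ :=
  (LinearMap.toContinuousLinearMap ((Module.finBasis ℂ E).coord i) : E →L[ℂ] ℂ)

theorem IsDualFrame.of_basis {T : Type*} [AddCommGroup T] [Module ℂ T] [TopologicalSpace T]
    {ι : Type*} [Fintype ι] (b : Module.Basis ι ℂ T) {z : ι → T →L[ℂ] ℂ}
    (hz : ∀ i v, z i v = b.repr v i) : IsDualFrame b z := by
  refine fun α ↦ ContinuousLinearMap.ext fun v ↦ ?_
  conv_rhs => rw [← b.sum_repr v, map_sum]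
  simp only [_root_.sum_apply, _root_.smul_apply, hz, map_smul, smul_eq_mul, mul_comm]

theorem isDualFrame_base (x : M) :
    IsDualFrame (fun i ↦ baseVec (E := E) i x) (fun i ↦ baseCovec i x) :=
  let b : Module.Basis (Fin (Module.finrank ℂ E)) ℂ (TangentSpace 𝓘(ℂ, E) x) :=
    Module.finBasis ℂ E
  .of_basis b fun _ _ ↦ rfl

variable [IsManifold 𝓘(ℂ, E) ω M]

variable (E) in
/-- A holomorphic local frame of the tangent bundle around `x₀`. -/
def frameVec (x₀ : M) (i : Fin (Module.finrank ℂ E)) (x : M) : TangentSpace 𝓘(ℂ, E) x :=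
  (trivializationAt E (TangentSpace 𝓘(ℂ, E) : M → Type _) x₀).localFrame (Module.finBasis ℂ E) i x

variable (E) in
/-- The dual frame of `frameVec`. -/
def frameCovec (x₀ : M) (i : Fin (Module.finrank ℂ E)) (x : M) :
    TangentSpace 𝓘(ℂ, E) x →L[ℂ] ℂ :=
  (LinearMap.toContinuousLinearMap ((Module.finBasis ℂ E).coord i) : E →L[ℂ] ℂ).comp
    ((trivializationAt E (TangentSpace 𝓘(ℂ, E) : M → Type _) x₀).continuousLinearMapAt ℂ x)

theorem isDualFrame_frame {x₀ x : M} (hx : x ∈ frameDomain E x₀) :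
    IsDualFrame (fun i ↦ frameVec E x₀ i x) (fun i ↦ frameCovec E x₀ i x) := by
  set t := trivializationAt E (TangentSpace 𝓘(ℂ, E) : M → Type _) x₀
  have hx' : x ∈ t.baseSet := hx
  have h : (fun i ↦ frameVec E x₀ i x) = t.basisAt (Module.finBasis ℂ E) hx' :=
    funext fun i ↦ t.localFrame_apply_of_mem_baseSet (Module.finBasis ℂ E) hx'
  rw [h]
  refine .of_basis _ fun i v ↦ ?_
  change (Module.finBasis ℂ E).repr (t.continuousLinearMapAt ℂ x v) i = _
  simp [Trivialization.basisAt, hx']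

theorem isHolDual_frameCovec {x₀ : M} {V : Opens M} (hV : V ≤ frameDomain E x₀)
    (i : Fin (Module.finrank ℂ E)) : IsHolDual E E V (frameCovec E x₀ i) := by
  set t := trivializationAt E (TangentSpace 𝓘(ℂ, E) : M → Type _) x₀
  set t' := trivializationAt ℂ (Bundle.Trivial M ℂ) x₀
  let T := Trivialization.continuousLinearMap (RingHom.id ℂ) t t'
  have hT : T.baseSet = t.baseSet := Set.inter_univ _
  have h := T.contMDiffOn_section_baseSet_iff (n := ω) (IB := 𝓘(ℂ, E)) (s := frameCovec E x₀ i)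
  rw [hT] at h
  refine (h.2 (ContMDiffOn.congr (contMDiffOn_const
    (c := LinearMap.toContinuousLinearMap ((Module.finBasis ℂ E).coord i)))
    fun x hx ↦ ContinuousLinearMap.ext fun v ↦ ?_)).mono (show (V : Set M) ⊆ t.baseSet from hV)
  calc (T ⟨x, frameCovec E x₀ i x⟩).2 v
      = t'.continuousLinearMapAt ℂ x (frameCovec E x₀ i x (t.symmL ℂ x v)) := by
        rw [Trivialization.continuousLinearMap_apply]; rfl
    _ = frameCovec E x₀ i x (t.symmL ℂ x v) := by
        rw [Trivialization.continuousLinearMapAt_apply, Trivialization.coe_linearMapAt_of_mem _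
          (Set.mem_univ x), Bundle.Trivial.eq_trivialization M ℂ t']
        rfl
    _ = (Module.finBasis ℂ E).coord i v :=
        congrArg ((Module.finBasis ℂ E).coord i) (t.continuousLinearMapAt_symmL (R := ℂ) hx v)

theorem contMDiffOn_apply_frameVec {x₀ : M} (i : Fin (Module.finrank ℂ E)) {V : Opens M}
    (hV : V ≤ frameDomain E x₀) {α : ∀ x : M, TangentSpace 𝓘(ℂ, E) x →L[ℂ] ℂ}
    (hα : IsHolDual E E V α) :
    ContMDiffOn 𝓘(ℂ, E) 𝓘(ℂ, ℂ) ω (fun x ↦ α x (frameVec E x₀ i x)) V := by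
  have hv : ContMDiffOn 𝓘(ℂ, E) (𝓘(ℂ, E).prod 𝓘(ℂ, E)) ω
      (fun x ↦ TotalSpace.mk' E x (frameVec E x₀ i x)) (frameDomain E x₀) :=
    Trivialization.contMDiffOn_localFrame_baseSet _ _ _ _
  have h := ContMDiffOn.clm_bundle_apply (E₂ := Bundle.Trivial M ℂ) (b := fun x ↦ x) hα
    (hv.mono hV)
  exact fun x hx ↦ (Bundle.contMDiffWithinAt_totalSpace.1 (h x hx)).2

end Frame

variable {r : ℕ} {𝔤 : Fin r → M → Type*}
  [∀ k x, AddCommGroup (𝔤 k x)] [∀ k x, Module ℂ (𝔤 k x)] [∀ k x, TopologicalSpace (𝔤 k x)]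
  [∀ k x, IsTopologicalAddGroup (𝔤 k x)] [∀ k x, ContinuousSMul ℂ (𝔤 k x)]

/-- A one-form as a section in form degree one. -/
def secForm (V : Opens M) (α : ∀ x : M, TangentSpace 𝓘(ℂ, E) x →L[ℂ] ℂ) : Sec E 𝔤 V :=
  fun x ↦ formGen _ (α x)

/-- A one-form as a section of symmetric generators. -/
def secSym (V : Opens M) (α : ∀ x : M, TangentSpace 𝓘(ℂ, E) x →L[ℂ] ℂ) : Sec E 𝔤 V :=
  fun x ↦ symGen _ (α x)

/-- The contraction of symmetric generators with a vector field. -/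
def secContract (v : ∀ x : M, TangentSpace 𝓘(ℂ, E) x) (U : Opens M) :
    Sec E 𝔤 U →ₗ[ℂ] Sec E 𝔤 U :=
  secOp (fun x ↦ symContract (G := fun k ↦ 𝔤 k x) (v x)) U

section

variable [FiniteDimensional ℂ E]

/-- The Koszul differential on sections, which turns symmetric generators into forms. -/
def secKoszul (U : Opens M) : Sec E 𝔤 U →ₗ[ℂ] Sec E 𝔤 U :=
  secOp (fun x ↦ fibreKoszul (G := fun k ↦ 𝔤 k x) (baseVec · x) (baseCovec · x)) U

/-- The adjoint Koszul differential on sections, which turns forms into symmetric generators. -/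
def secCoKoszul (U : Opens M) : Sec E 𝔤 U →ₗ[ℂ] Sec E 𝔤 U :=
  secOp (fun x ↦ fibreCoKoszul (G := fun k ↦ 𝔤 k x) (baseVec · x) (baseCovec · x)) U

theorem secKoszul_secSym {U : Opens M} (α : ∀ x : M, TangentSpace 𝓘(ℂ, E) x →L[ℂ] ℂ) :
    secKoszul U (secSym U α) = (secForm U α : Sec E 𝔤 U) :=
  funext fun x ↦ (isDualFrame_base (x : M)).fibreKoszul_symGen (α x)

theorem secCoKoszul_secForm {U : Opens M} (α : ∀ x : M, TangentSpace 𝓘(ℂ, E) x →L[ℂ] ℂ) :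
    secCoKoszul U (secForm U α) = (secSym U α : Sec E 𝔤 U) :=
  funext fun x ↦ (isDualFrame_base (x : M)).fibreCoKoszul_formGen (α x)

theorem secKoszul_secSym_mul {U : Opens M} (α : ∀ x : M, TangentSpace 𝓘(ℂ, E) x →L[ℂ] ℂ)
    (s : Sec E 𝔤 U) :
    secKoszul U (secSym U α * s) = secForm U α * s + secSym U α * secKoszul U s := by
  refine (secOp_mul (fun _ _ ↦ isSkewDerivation_fibreKoszul _ _) _ s).trans ?_
  exact congrArg₂ (· * s + · * secKoszul U s) (secKoszul_secSym α)
    (funext fun x ↦ fibreParity_symGen (α x))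

end

variable [IsManifold 𝓘(ℂ, E) ω M]
  {F : Fin r → Type*} [∀ k, NormedAddCommGroup (F k)] [∀ k, NormedSpace ℂ (F k)]
  [∀ k, TopologicalSpace (TotalSpace (F k) (𝔤 k))]
  [∀ k, FiberBundle (F k) (𝔤 k)] [∀ k, VectorBundle ℂ (F k) (𝔤 k)]

theorem HolPoly.isShifted_secContract {V : Opens M} {v : ∀ x : M, TangentSpace 𝓘(ℂ, E) x}
    (hv : ∀ α, IsHolDual E E V α → ContMDiffOn 𝓘(ℂ, E) 𝓘(ℂ, ℂ) ω (fun x ↦ α x (v x)) V)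
    {m : Deg} {s : Sec E 𝔤 V} (hs : HolPoly E F 𝔤 V m s) :
    IsShifted E F 𝔤 (.single 1 1) 0 V m (secContract v V s) := by
  refine hs.isShifted (σ := fun x ↦ AlgHom.id ℂ _) (fun x _ ↦ isSkewDerivation_symContract (v x))
    (fun hs ↦ hs) (fun α _ ↦ .inl ?_) (fun α hα ↦ .of_holPoly ?_)
    fun x _ ↦ symContract_wGen (G := fun k ↦ 𝔤 k x) (v x)
  · exact secOp_apply_eq_zero fun x ↦ symContract_formGen (v x) (α x)
  · have h : secContract v V (secSym V α) =
        (fun x : V ↦ algebraMap ℂ (AlgAt E 𝔤 (x : M)) (α x (v x)) : Sec E 𝔤 V) :=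
      funext fun x ↦ symContract_symGen (v x) (α x)
    exact h ▸ HolPoly.fn (fun x ↦ α x (v x)) (hv α hα)

theorem HolPoly.sum_secSym_mul_secContract {V : Opens M} {ι : Type*} [Fintype ι]
    {e : ι → ∀ x : M, TangentSpace 𝓘(ℂ, E) x}
    {z : ι → ∀ x : M, TangentSpace 𝓘(ℂ, E) x →L[ℂ] ℂ}
    (h : ∀ x ∈ V, IsDualFrame (fun i ↦ e i x) (fun i ↦ z i x))
    {m : Deg} {s : Sec E 𝔤 V} (hs : HolPoly E F 𝔤 V m s) :
    ∑ i, secSym V (z i) * secContract (e i) V s = (m 1 : ℂ) • s := by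
  have hsum : secOp (fun x ↦ fibreEuler (G := fun k ↦ 𝔤 k x) (e · x) (z · x)) V s =
      ∑ i, secSym V (z i) * secContract (e i) V s :=
    funext fun x ↦ (sumMulLeft_apply (s x)).trans (Finset.sum_apply x Finset.univ
      fun i ↦ (secSym V (z i) * secContract (e i) V s : Sec E 𝔤 V)).symm
  rw [← hsum, hs.secOp_eq_smul (a := 0) (b := 1) (fun x _ ↦ isSkewDerivation_fibreEuler _ _)
    (fun x _ α ↦ (fibreEuler_formGen _ _ α).trans (zero_smul ℂ _).symm)
    (fun x hx α ↦ ((h x hx).fibreEuler_symGen α).trans (one_smul ℂ _).symm)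
    (fun x _ ↦ fibreEuler_wGen (G := fun k ↦ 𝔤 k x) _ _), zero_mul, one_mul, zero_add]

variable [FiniteDimensional ℂ E]

theorem HolPoly.isShifted_secKoszul {V : Opens M} {m : Deg} {s : Sec E 𝔤 V}
    (hs : HolPoly E F 𝔤 V m s) :
    IsShifted E F 𝔤 (.single 1 1) (.single 0 1) V m (secKoszul V s) := by
  refine hs.isShifted (fun x _ ↦ isSkewDerivation_fibreKoszul _ _)
    (fun hs ↦ hs.secOp_fibreParity ▸ hs.smul _) (fun α _ ↦ .inl ?_) (fun α hα ↦ .of_holPoly ?_)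
    fun x _ ↦ fibreKoszul_wGen (G := fun k ↦ 𝔤 k x) _ _
  · exact secOp_apply_eq_zero fun x ↦ fibreKoszul_formGen _ _ (α x)
  · exact secKoszul_secSym (𝔤 := 𝔤) α ▸ HolPoly.form α hα

theorem HolPoly.isShifted_secCoKoszul {V : Opens M} {m : Deg} {s : Sec E 𝔤 V}
    (hs : HolPoly E F 𝔤 V m s) :
    IsShifted E F 𝔤 (.single 0 1) (.single 1 1) V m (secCoKoszul V s) := by
  refine hs.isShifted (fun x _ ↦ isSkewDerivation_fibreCoKoszul _ _)
    (fun hs ↦ hs.secOp_fibreParity ▸ hs.smul _) (fun α hα ↦ .of_holPoly ?_) (fun α _ ↦ .inl ?_)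
    fun x _ ↦ fibreCoKoszul_wGen (G := fun k ↦ 𝔤 k x) _ _
  · exact secCoKoszul_secForm (𝔤 := 𝔤) α ▸ HolPoly.sym α hα
  · exact secOp_apply_eq_zero fun x ↦ fibreCoKoszul_symGen _ _ (α x)

theorem HolPoly.secKoszul_secCoKoszul_add {V : Opens M} {m : Deg} {s : Sec E 𝔤 V}
    (hs : HolPoly E F 𝔤 V m s) :
    secKoszul V (secCoKoszul V s) + secCoKoszul V (secKoszul V s) = (m 0 + m 1 : ℂ) • s := by
  refine (hs.secOp_eq_smul (f := fun x ↦ fibreLaplacian (baseVec · x) (baseCovec · x))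
    (a := 1) (b := 1) (fun x _ ↦ isSkewDerivation_fibreLaplacian _ _)
    (fun x _ α ↦ ((isDualFrame_base x).fibreLaplacian_formGen α).trans (one_smul ℂ _).symm)
    (fun x _ α ↦ ((isDualFrame_base x).fibreLaplacian_symGen α).trans (one_smul ℂ _).symm)
    fun x _ ↦ fibreLaplacian_wGen (G := fun k ↦ 𝔤 k x) _ _).trans ?_
  rw [one_mul, one_mul]

end Koszul

/-! ### Koszul differentials on formal power series -/

section Series

variable {E : Type*} [NormedAddCommGroup E] [NormedSpace ℂ E]
  {M : Type*} [TopologicalSpace M] [ChartedSpace E M]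
  {r : ℕ} {F : Fin r → Type*} {𝔤 : Fin r → M → Type*}
  [∀ k x, AddCommGroup (𝔤 k x)] [∀ k x, Module ℂ (𝔤 k x)] [∀ k x, TopologicalSpace (𝔤 k x)]
  [∀ k x, IsTopologicalAddGroup (𝔤 k x)] [∀ k x, ContinuousSMul ℂ (𝔤 k x)]

theorem Sec.ext_of_locally {U : Opens M} {s t : Sec E 𝔤 U}
    (h : ∀ x ∈ U, ∃ (V : Opens M) (hV : V ≤ U), x ∈ V ∧ resSec E 𝔤 hV s = resSec E 𝔤 hV t) :
    s = t :=
  funext fun x ↦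
    have ⟨_, _, hx, hst⟩ := h x x.2
    congrFun hst ⟨x, hx⟩

variable [IsManifold 𝓘(ℂ, E) ω M] [∀ k, NormedAddCommGroup (F k)] [∀ k, NormedSpace ℂ (F k)]
  [∀ k, TopologicalSpace (TotalSpace (F k) (𝔤 k))]
  [∀ k, FiberBundle (F k) (𝔤 k)] [∀ k, VectorBundle ℂ (F k) (𝔤 k)]

/-- The component of multidegree `m`. -/
def component {U : Opens M} (m : Deg) : CEAlg E F 𝔤 U →ₗ[ℂ] Sec E 𝔤 U where
  toFun a := MvPowerSeries.coeff m a.1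
  map_add' _ _ := rfl
  map_smul' _ _ := rfl

theorem ext_component {U : Opens M} {a b : CEAlg E F 𝔤 U}
    (h : ∀ m, component m a = component m b) : a = b :=
  Subtype.ext (MvPowerSeries.ext h)

theorem isHol_component {U : Opens M} (m : Deg) (a : CEAlg E F 𝔤 U) :
    IsHol E F 𝔤 U m (component m a) :=
  a.2 m

theorem component_res {U V : Opens M} (h : V ≤ U) (m : Deg) (a : CEAlg E F 𝔤 U) :
    component m (res E F 𝔤 h a) = resSec E 𝔤 h (component m a) :=
  MvPowerSeries.coeff_map (resSec E 𝔤 h : _ →ₐ[ℂ] _).toRingHom m a.1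

theorem component_trunc_of_pos {U : Opens M} {S : Deg → Prop} {m : Deg} (h : S m)
    (a : CEAlg E F 𝔤 U) : component m (trunc E F 𝔤 S a) = component m a :=
  coeff_truncFun_of_pos E 𝔤 h a.1

theorem component_trunc_of_neg {U : Opens M} {S : Deg → Prop} {m : Deg} (h : ¬ S m)
    (a : CEAlg E F 𝔤 U) : component m (trunc E F 𝔤 S a) = 0 :=
  coeff_truncFun_of_neg E 𝔤 h a.1

theorem mem_supp_iff {U : Opens M} {S : Deg → Prop} {a : CEAlg E F 𝔤 U} :
    a ∈ supp E F 𝔤 U S ↔ ∀ m, ¬ S m → component m a = 0 :=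
  Iff.rfl

theorem mem_supp_of_locally {U : Opens M} {S : Deg → Prop} {a : CEAlg E F 𝔤 U}
    (h : ∀ x ∈ U, ∃ (V : Opens M) (hV : V ≤ U), x ∈ V ∧ res E F 𝔤 hV a ∈ supp E F 𝔤 V S) :
    a ∈ supp E F 𝔤 U S :=
  mem_supp_iff.2 fun m hm ↦ Sec.ext_of_locally fun x hx ↦
    have ⟨V, hV, hxV, ha⟩ := h x hx
    ⟨V, hV, hxV, by rw [← component_res, mem_supp_iff.1 ha m hm, map_zero]⟩

/-- The operator on series with prescribed components. -/
def ofComponents {U : Opens M} (φ : Deg → CEAlg E F 𝔤 U →ₗ[ℂ] Sec E 𝔤 U)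
    (hφ : ∀ m a, IsHol E F 𝔤 U m (φ m a)) : CEAlg E F 𝔤 U →ₗ[ℂ] CEAlg E F 𝔤 U where
  toFun a := ⟨fun m ↦ φ m a, fun m ↦ hφ m a⟩
  map_add' a b := ext_component fun m ↦ map_add (φ m) a b
  map_smul' c a := ext_component fun m ↦ map_smul (φ m) c a

theorem component_ofComponents {U : Opens M} (φ : Deg → CEAlg E F 𝔤 U →ₗ[ℂ] Sec E 𝔤 U)
    (hφ : ∀ m a, IsHol E F 𝔤 U m (φ m a)) (m : Deg) (a : CEAlg E F 𝔤 U) :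
    component m (ofComponents φ hφ a) = φ m a :=
  rfl

section ShiftOp

variable (F) in
/-- The operator `φ` on sections is homogeneous of multidegree `d₂ - d₁`, and it kills the sections
whose multidegree does not allow `d₁` to be subtracted. -/
structure ShiftsDeg (d₁ d₂ : Deg) {U : Opens M} (φ : Sec E 𝔤 U →ₗ[ℂ] Sec E 𝔤 U) : Prop where
  isHol : ∀ {m s}, IsHol E F 𝔤 U (m + d₁) s → IsHol E F 𝔤 U (m + d₂) (φ s)
  eq_zero : ∀ {m s}, IsHol E F 𝔤 U m s → ¬ d₁ ≤ m → φ s = 0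

theorem shiftsDeg_secOp {f : ∀ x : M, AlgAt E 𝔤 x →ₗ[ℂ] AlgAt E 𝔤 x} {U : Opens M} {d₁ d₂ : Deg}
    (h : ∀ V ≤ U, ∀ {m s}, HolPoly E F 𝔤 V m s → IsShifted E F 𝔤 d₁ d₂ V m (secOp f V s)) :
    ShiftsDeg F d₁ d₂ (secOp f U) where
  isHol hs x hx :=
    have ⟨V, hV, hxV, hp⟩ := hs x hx
    ⟨V, hV, hxV, (h V hV hp).holPoly⟩
  eq_zero hs hm := Sec.ext_of_locally fun x hx ↦
    have ⟨V, hV, hxV, hp⟩ := hs x hx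
    ⟨V, hV, hxV, by rw [resSec_secOp, (h V hV hp).eq_zero hm, map_zero]⟩

open Classical in
/-- The operator on series that applies an operator on sections of multidegree `d₂ - d₁` to all
components. -/
def shiftOp {d₁ d₂ : Deg} {U : Opens M} {φ : Sec E 𝔤 U →ₗ[ℂ] Sec E 𝔤 U}
    (hφ : ShiftsDeg F d₁ d₂ φ) : CEAlg E F 𝔤 U →ₗ[ℂ] CEAlg E F 𝔤 U :=
  ofComponents (fun m ↦ if d₂ ≤ m then φ ∘ₗ component (m - d₂ + d₁) else 0) fun m a ↦ by
    split_ifs with h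
    · have hs := hφ.isHol (isHol_component (m - d₂ + d₁) a)
      rwa [tsub_add_cancel_of_le h] at hs
    · exact IsHol.zero U m

variable {d₁ d₂ : Deg} {U : Opens M} {φ ψ : Sec E 𝔤 U →ₗ[ℂ] Sec E 𝔤 U}

theorem component_add_shiftOp (hφ : ShiftsDeg F d₁ d₂ φ) (m : Deg) (a : CEAlg E F 𝔤 U) :
    component (m + d₂) (shiftOp hφ a) = φ (component (m + d₁) a) := by
  rw [shiftOp, component_ofComponents, if_pos le_add_self, add_tsub_cancel_right,
    LinearMap.comp_apply]

theorem component_shiftOp_of_not_le (hφ : ShiftsDeg F d₁ d₂ φ) {m : Deg} (hm : ¬ d₂ ≤ m)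
    (a : CEAlg E F 𝔤 U) : component m (shiftOp hφ a) = 0 := by
  rw [shiftOp, component_ofComponents, if_neg hm, LinearMap.zero_apply]

theorem shiftOp_res {f : ∀ x : M, AlgAt E 𝔤 x →ₗ[ℂ] AlgAt E 𝔤 x} {V : Opens M} (h : V ≤ U)
    (hU : ShiftsDeg F d₁ d₂ (secOp f U)) (hV : ShiftsDeg F d₁ d₂ (secOp f V))
    (a : CEAlg E F 𝔤 U) : shiftOp hV (res E F 𝔤 h a) = res E F 𝔤 h (shiftOp hU a) := by
  refine ext_component fun m ↦ ?_
  rw [component_res]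
  by_cases hm : d₂ ≤ m
  · obtain ⟨n, rfl⟩ := le_iff_exists_add'.1 hm
    rw [component_add_shiftOp, component_add_shiftOp, component_res, resSec_secOp]
  · rw [component_shiftOp_of_not_le hV hm, component_shiftOp_of_not_le hU hm, map_zero]

theorem component_shiftOp_shiftOp (hψ : ShiftsDeg F d₂ d₁ ψ) (hφ : ShiftsDeg F d₁ d₂ φ) (m : Deg)
    (a : CEAlg E F 𝔤 U) :
    component m (shiftOp hψ (shiftOp hφ a)) = ψ (φ (component m a)) := by
  by_cases hm : d₁ ≤ m
  · obtain ⟨n, rfl⟩ := le_iff_exists_add'.1 hm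
    rw [component_add_shiftOp, component_add_shiftOp]
  · rw [component_shiftOp_of_not_le hψ hm, hφ.eq_zero (isHol_component m a) hm, map_zero]

end ShiftOp

section Weight

variable {U : Opens M}

/-- The operator on series that multiplies the component of multidegree `m` by `c m`. -/
def weight (c : Deg → ℂ) : CEAlg E F 𝔤 U →ₗ[ℂ] CEAlg E F 𝔤 U :=
  ofComponents (fun m ↦ c m • component m) fun m a ↦ (isHol_component m a).smul (c m)

theorem component_weight (c : Deg → ℂ) (m : Deg) (a : CEAlg E F 𝔤 U) :
    component m (weight c a) = c m • component m a :=
  rfl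

theorem weight_mem_supp (c : Deg → ℂ) {S : Deg → Prop} {a : CEAlg E F 𝔤 U}
    (ha : a ∈ supp E F 𝔤 U S) : weight c a ∈ supp E F 𝔤 U S :=
  mem_supp_iff.2 fun m hm ↦ by rw [component_weight, mem_supp_iff.1 ha m hm, smul_zero]

theorem weight_res (c : Deg → ℂ) {V : Opens M} (h : V ≤ U) (a : CEAlg E F 𝔤 U) :
    weight c (res E F 𝔤 h a) = res E F 𝔤 h (weight c a) :=
  ext_component fun m ↦ by
    rw [component_res, component_weight, component_weight, component_res, map_smul]

theorem shiftOp_weight {d₁ d₂ : Deg} {φ : Sec E 𝔤 U →ₗ[ℂ] Sec E 𝔤 U}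
    (hφ : ShiftsDeg F d₁ d₂ φ) {c : Deg → ℂ} (hc : ∀ m, c (m + d₁) = c (m + d₂))
    (a : CEAlg E F 𝔤 U) : shiftOp hφ (weight c a) = weight c (shiftOp hφ a) := by
  refine ext_component fun m ↦ ?_
  rw [component_weight]
  by_cases hm : d₂ ≤ m
  · obtain ⟨n, rfl⟩ := le_iff_exists_add'.1 hm
    rw [component_add_shiftOp, component_add_shiftOp, component_weight, map_smul, hc]
  · rw [component_shiftOp_of_not_le hφ hm, component_shiftOp_of_not_le hφ hm, smul_zero]

end Weight

section Homogeneous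

variable {U : Opens M} {d : Deg} {s : Sec E 𝔤 U}

/-- A holomorphic section of multidegree `d` as a homogeneous element of the algebra. -/
def homogeneous (hs : IsHol E F 𝔤 U d s) : CEAlg E F 𝔤 U :=
  ⟨MvPowerSeries.monomial d s, fun m ↦ by
    classical
    rw [MvPowerSeries.coeff_monomial]
    split_ifs with h
    · exact h ▸ hs
    · exact IsHol.zero U m⟩

theorem component_homogeneous (hs : IsHol E F 𝔤 U d s) : component d (homogeneous hs) = s :=
  MvPowerSeries.coeff_monomial_same d s

theorem homogeneous_mem_supp (hs : IsHol E F 𝔤 U d s) {S : Deg → Prop} (hS : S d) :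
    homogeneous hs ∈ supp E F 𝔤 U S :=
  fun m hm ↦ MvPowerSeries.coeff_monomial_ne (fun h : m = d ↦ hm (by rwa [h])) s

theorem component_add_homogeneous_mul (hs : IsHol E F 𝔤 U d s) (m : Deg) (a : CEAlg E F 𝔤 U) :
    component (m + d) (homogeneous hs * a) = s * component m a := by
  rw [add_comm]
  exact MvPowerSeries.coeff_add_monomial_mul _ _ _ _

theorem component_homogeneous_mul_of_not_le (hs : IsHol E F 𝔤 U d s) {m : Deg} (hm : ¬ d ≤ m)
    (a : CEAlg E F 𝔤 U) : component m (homogeneous hs * a) = 0 :=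
  (MvPowerSeries.coeff_monomial_mul _ _ _ _).trans (if_neg hm)

end Homogeneous

/-- The condition defining the filtration by the number of symmetric generators from `Ω_M`. -/
def symFilt (n : ℕ) (m : Deg) : Prop := n ≤ m 1

theorem mul_mem_symFilt {U : Opens M} {k n : ℕ} {a b : CEAlg E F 𝔤 U}
    (ha : a ∈ supp E F 𝔤 U (symFilt k)) (hb : b ∈ supp E F 𝔤 U (symFilt n)) :
    a * b ∈ supp E F 𝔤 U (symFilt (k + n)) := by
  classical
  intro m hm
  refine (MvPowerSeries.coeff_mul _ _ _).trans (Finset.sum_eq_zero fun p hp ↦ ?_)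
  obtain rfl := Finset.HasAntidiagonal.mem_antidiagonal.1 hp
  by_cases h : symFilt k p.1
  · rw [hb p.2 fun h' ↦ hm (add_le_add h h'), mul_zero]
  · rw [ha p.1 h, zero_mul]

theorem isHol_secForm {U : Opens M} {α : ∀ x : M, TangentSpace 𝓘(ℂ, E) x →L[ℂ] ℂ}
    (hα : IsHolDual E E U α) : IsHol E F 𝔤 U (.single 0 1) (secForm U α) :=
  fun _ hx ↦ ⟨U, le_rfl, hx, .form α hα⟩

theorem isHol_secSym {U : Opens M} {α : ∀ x : M, TangentSpace 𝓘(ℂ, E) x →L[ℂ] ℂ}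
    (hα : IsHolDual E E U α) : IsHol E F 𝔤 U (.single 1 1) (secSym U α) :=
  fun _ hx ↦ ⟨U, le_rfl, hx, .sym α hα⟩

theorem homogeneous_secSym_mem_bideg {U : Opens M} {α : ∀ x : M, TangentSpace 𝓘(ℂ, E) x →L[ℂ] ℂ}
    (hα : IsHolDual E E U α) :
    (homogeneous (isHol_secSym hα) : CEAlg E F 𝔤 U) ∈ supp E F 𝔤 U (bideg 0 0) :=
  homogeneous_mem_supp _ (by simp [bideg])

variable [FiniteDimensional ℂ E]

theorem shiftsDeg_secKoszul (U : Opens M) :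
    ShiftsDeg F (.single 1 1) (.single 0 1) (secKoszul (E := E) (𝔤 := 𝔤) U) :=
  shiftsDeg_secOp fun _ _ _ _ hs ↦ hs.isShifted_secKoszul

theorem shiftsDeg_secCoKoszul (U : Opens M) :
    ShiftsDeg F (.single 0 1) (.single 1 1) (secCoKoszul (E := E) (𝔤 := 𝔤) U) :=
  shiftsDeg_secOp fun _ _ _ _ hs ↦ hs.isShifted_secCoKoszul

variable (E F 𝔤) in
/-- The Koszul differential on `Ω_M^* ⊗ C^*𝔤`, the part of `D` that lowers the number of symmetric
generators. -/
def koszul (U : Opens M) : CEAlg E F 𝔤 U →ₗ[ℂ] CEAlg E F 𝔤 U :=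
  shiftOp (shiftsDeg_secKoszul U)

variable (E F 𝔤) in
/-- The contracting homotopy for the Koszul differential. The weight at `m 0 + m 1 = 0`, where
inversion gives `0`, is harmless since `secCoKoszul` vanishes there. -/
def koszulHomotopy (U : Opens M) : CEAlg E F 𝔤 U →ₗ[ℂ] CEAlg E F 𝔤 U :=
  weight (fun m ↦ (m 0 + m 1 : ℂ)⁻¹) ∘ₗ shiftOp (shiftsDeg_secCoKoszul U)

theorem koszul_koszulHomotopy_add (U : Opens M) (a : CEAlg E F 𝔤 U) :
    koszul E F 𝔤 U (koszulHomotopy E F 𝔤 U a) + koszulHomotopy E F 𝔤 U (koszul E F 𝔤 U a) =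
      a - trunc E F 𝔤 wOnly a := by
  refine ext_component fun m ↦ ?_
  have hlap : secKoszul U (secCoKoszul U (component m a)) +
      secCoKoszul U (secKoszul U (component m a)) = (m 0 + m 1 : ℂ) • component m a :=
    Sec.ext_of_locally fun x hx ↦
      have ⟨V, hV, hxV, hp⟩ := isHol_component m a x hx
      ⟨V, hV, hxV, hp.secKoszul_secCoKoszul_add⟩
  rw [map_add, map_sub, koszulHomotopy, LinearMap.comp_apply, LinearMap.comp_apply, koszul,
    shiftOp_weight _ (fun m ↦ by simp; ring), component_weight, component_weight,
    component_shiftOp_shiftOp, component_shiftOp_shiftOp, ← smul_add, hlap, smul_smul]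
  by_cases hm : wOnly m
  · simp [component_trunc_of_pos hm, hm.1, hm.2]
  · have h0 : (m 0 + m 1 : ℂ) ≠ 0 := by
      norm_cast
      exact fun h ↦ hm ⟨by omega, by omega⟩
    rw [component_trunc_of_neg hm, inv_mul_cancel₀ h0, one_smul, sub_zero]

theorem koszul_secSym_mul {U : Opens M} {α : ∀ x : M, TangentSpace 𝓘(ℂ, E) x →L[ℂ] ℂ}
    (hα : IsHolDual E E U α) (a : CEAlg E F 𝔤 U) :
    koszul E F 𝔤 U (homogeneous (isHol_secSym hα) * a) =
      homogeneous (isHol_secForm hα) * a +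
        homogeneous (isHol_secSym hα) * koszul E F 𝔤 U a := by
  refine ext_component fun m ↦ ?_
  rw [map_add, koszul]
  by_cases h0 : .single 0 1 ≤ m
  · obtain ⟨n, rfl⟩ := le_iff_exists_add'.1 h0
    rw [component_add_shiftOp, component_add_homogeneous_mul, component_add_homogeneous_mul,
      secKoszul_secSym_mul]
    congr 1
    by_cases h1 : .single 1 1 ≤ n
    · obtain ⟨n, rfl⟩ := le_iff_exists_add'.1 h1
      rw [add_right_comm, component_add_homogeneous_mul, component_add_shiftOp]
    · rw [(shiftsDeg_secKoszul U).eq_zero (isHol_component n a) h1, mul_zero,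
        component_homogeneous_mul_of_not_le _ (by simpa using h1)]
  · rw [component_shiftOp_of_not_le _ h0, component_homogeneous_mul_of_not_le _ h0, zero_add]
    by_cases h1 : .single 1 1 ≤ m
    · obtain ⟨n, rfl⟩ := le_iff_exists_add'.1 h1
      rw [component_add_homogeneous_mul, component_shiftOp_of_not_le _ (by simpa using h0),
        mul_zero]
    · rw [component_homogeneous_mul_of_not_le _ h1]

section Division

variable {x₀ : M} {V : Opens M}

theorem shiftsDeg_secContract (hV : V ≤ frameDomain E x₀) (i : Fin (Module.finrank ℂ E)) :
    ShiftsDeg F (.single 1 1) 0 (secContract (𝔤 := 𝔤) (frameVec E x₀ i) V) :=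
  shiftsDeg_secOp fun _ hW _ _ hs ↦
    hs.isShifted_secContract fun _ ↦ contMDiffOn_apply_frameVec i (hW.trans hV)

variable (F 𝔤) in
/-- The `i`-th element of the local frame of `Ω_M` around `x₀`, as a symmetric generator. -/
def frameSym (hV : V ≤ frameDomain E x₀) (i : Fin (Module.finrank ℂ E)) : CEAlg E F 𝔤 V :=
  homogeneous (isHol_secSym (isHolDual_frameCovec hV i))

theorem sum_frameSym_mul_contract (hV : V ≤ frameDomain E x₀) (a : CEAlg E F 𝔤 V) :
    ∑ i, frameSym F 𝔤 hV i * shiftOp (shiftsDeg_secContract hV i) a =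
      weight (fun m ↦ (m 1 : ℂ)) a := by
  refine ext_component fun m ↦ ?_
  rw [map_sum, component_weight]
  by_cases hm : .single 1 1 ≤ m
  · obtain ⟨n, rfl⟩ := le_iff_exists_add'.1 hm
    set s := component (n + .single 1 1) a
    have h (i) : component (n + .single 1 1)
        (frameSym F 𝔤 hV i * shiftOp (shiftsDeg_secContract hV i) a) =
          secSym V (frameCovec E x₀ i) * secContract (frameVec E x₀ i) V s := by
      rw [frameSym, component_add_homogeneous_mul]
      exact congrArg (_ * ·) (add_zero n ▸ component_add_shiftOp (shiftsDeg_secContract hV i) n a)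
    rw [Finset.sum_congr rfl fun i _ ↦ h i]
    refine Sec.ext_of_locally fun x hx ↦ ?_
    obtain ⟨W, hW, hxW, hp⟩ := isHol_component (n + .single 1 1) a x hx
    refine ⟨W, hW, hxW, ?_⟩
    rw [map_sum, map_smul]
    exact hp.sum_secSym_mul_secContract fun x hx ↦ isDualFrame_frame (hV (hW hx))
  · have h1 : m 1 = 0 := by simpa [Finsupp.single_le_iff] using hm
    rw [h1, Nat.cast_zero, zero_smul]
    exact Finset.sum_eq_zero fun i _ ↦ component_homogeneous_mul_of_not_le _ hm _

theorem exists_sum_frameSym_mul (hV : V ≤ frameDomain E x₀) {n : ℕ} {a : CEAlg E F 𝔤 V}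
    (ha : a ∈ supp E F 𝔤 V (symFilt (n + 1))) :
    ∃ b : Fin (Module.finrank ℂ E) → CEAlg E F 𝔤 V,
      (∀ i, b i ∈ supp E F 𝔤 V (symFilt n)) ∧ ∑ i, frameSym F 𝔤 hV i * b i = a := by
  refine ⟨fun i ↦ shiftOp (shiftsDeg_secContract hV i) (weight (fun m ↦ (m 1 : ℂ)⁻¹) a),
    fun i ↦ mem_supp_iff.2 fun m hm ↦ ?_, ?_⟩
  · rw [← add_zero m, component_add_shiftOp,
      mem_supp_iff.1 (weight_mem_supp _ ha) _ (by simpa [symFilt] using hm), map_zero]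
  · rw [sum_frameSym_mul_contract]
    refine ext_component fun m ↦ ?_
    rw [component_weight, component_weight, smul_smul]
    by_cases hm : symFilt (n + 1) m
    · have h0 : (m 1 : ℂ) ≠ 0 := Nat.cast_ne_zero.2 (Nat.ne_zero_of_lt hm)
      rw [mul_inv_cancel₀ h0, one_smul]
    · rw [mem_supp_iff.1 ha m hm, smul_zero]

end Division

end Series

/-! ### The symmetric filtration -/

section Series

variable {E : Type*} [NormedAddCommGroup E] [NormedSpace ℂ E]
  {M : Type*} [TopologicalSpace M] [ChartedSpace E M] [IsManifold 𝓘(ℂ, E) ω M]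
  {r : ℕ} {F : Fin r → Type*} [∀ k, NormedAddCommGroup (F k)] [∀ k, NormedSpace ℂ (F k)]
  {𝔤 : Fin r → M → Type*} [∀ k, TopologicalSpace (TotalSpace (F k) (𝔤 k))]
  [∀ k x, AddCommGroup (𝔤 k x)] [∀ k x, Module ℂ (𝔤 k x)] [∀ k x, TopologicalSpace (𝔤 k x)]
  [∀ k x, IsTopologicalAddGroup (𝔤 k x)] [∀ k x, ContinuousSMul ℂ (𝔤 k x)]
  [∀ k, FiberBundle (F k) (𝔤 k)] [∀ k, VectorBundle ℂ (F k) (𝔤 k)]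

section Trunc

variable {U : Opens M} {S S' : Deg → Prop} {a : CEAlg E F 𝔤 U}

theorem supp_mono (h : ∀ m, S m → S' m) : supp E F 𝔤 U S ≤ supp E F 𝔤 U S' :=
  fun _ ha m hm ↦ ha m fun hS ↦ hm (h m hS)

theorem trunc_mem_supp (S : Deg → Prop) (a : CEAlg E F 𝔤 U) : trunc E F 𝔤 S a ∈ supp E F 𝔤 U S :=
  mem_supp_iff.2 fun _ hm ↦ component_trunc_of_neg hm a

theorem trunc_mem_supp_and (ha : a ∈ supp E F 𝔤 U S) :
    trunc E F 𝔤 S' a ∈ supp E F 𝔤 U fun m ↦ S m ∧ S' m :=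
  mem_supp_iff.2 fun m hm ↦ by
    by_cases h : S' m
    · rw [component_trunc_of_pos h, mem_supp_iff.1 ha m fun hS ↦ hm ⟨hS, h⟩]
    · rw [component_trunc_of_neg h]

theorem trunc_eq_self (ha : a ∈ supp E F 𝔤 U S) : trunc E F 𝔤 S a = a :=
  ext_component fun m ↦ by
    by_cases h : S m
    · rw [component_trunc_of_pos h]
    · rw [component_trunc_of_neg h, mem_supp_iff.1 ha m h]

theorem trunc_add_trunc_not (S : Deg → Prop) (a : CEAlg E F 𝔤 U) :
    trunc E F 𝔤 S a + trunc E F 𝔤 (fun m ↦ ¬ S m) a = a :=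
  ext_component fun m ↦ by
    rw [map_add]
    by_cases h : S m
    · rw [component_trunc_of_pos h, component_trunc_of_neg (not_not.2 h), add_zero]
    · rw [component_trunc_of_neg h, component_trunc_of_pos h, zero_add]

theorem trunc_res (S : Deg → Prop) {V : Opens M} (h : V ≤ U) (a : CEAlg E F 𝔤 U) :
    trunc E F 𝔤 S (res E F 𝔤 h a) = res E F 𝔤 h (trunc E F 𝔤 S a) :=
  ext_component fun m ↦ by
    rw [component_res]
    by_cases hm : S m
    · rw [component_trunc_of_pos hm, component_trunc_of_pos hm, component_res]
    · rw [component_trunc_of_neg hm, component_trunc_of_neg hm, map_zero]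

end Trunc

section LInftySpace

variable [∀ k, ContMDiffVectorBundle ω (F k) (𝔤 k) 𝓘(ℂ, E)]

theorem Q_secSym_mul (L : LInftyStructure E F 𝔤) {V : Opens M}
    {α : ∀ x : M, TangentSpace 𝓘(ℂ, E) x →L[ℂ] ℂ}
    (hα : IsHolDual E E V α) (b : CEAlg E F 𝔤 V) :
    L.Q V (homogeneous (isHol_secSym hα) * b) = homogeneous (isHol_secSym hα) * L.Q V b := by
  have hy := homogeneous_secSym_mem_bideg (F := F) (𝔤 := 𝔤) hα
  have hQ : L.Q V (homogeneous (isHol_secSym hα)) = 0 :=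
    ext_component fun m ↦ coeff_Q_eq_zero L hy fun m' h h' ↦ by
      have := h.2.symm.trans h'.2
      omega
  rw [L.Q_mul V 0 0 _ _ hy, hQ, zero_mul, zero_add, add_zero, pow_zero, one_smul]

variable {L : LInftyStructure E F 𝔤} (D : GrothendieckConnection L)

theorem D_secSym_sub_secForm_mem_symFilt {V : Opens M}
    {α : ∀ x : M, TangentSpace 𝓘(ℂ, E) x →L[ℂ] ℂ} (hα : IsHolDual E E V α) :
    D.D V (homogeneous (isHol_secSym hα)) - homogeneous (isHol_secForm hα) ∈
      supp E F 𝔤 V (symFilt 1) := by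
  refine mem_supp_iff.2 fun m hm ↦ ?_
  have hm1 : m 1 = 0 := Nat.lt_one_iff.1 (not_le.1 hm)
  rw [map_sub, sub_eq_zero]
  by_cases h : m = .single 0 1
  · rw [h, component_homogeneous]
    exact D.D_sym V _ α hα rfl
  · rw [mem_supp_iff.1 (homogeneous_mem_supp _ (S := (· = .single 0 1)) rfl) m h]
    refine coeff_D_eq_zero D (homogeneous_secSym_mem_bideg hα) fun m' h0 h2 h' ↦ h ?_
    ext j
    fin_cases j
    · simp [← h0, h'.1]
    · simpa using hm1
    · simp [← h2, h'.2]

theorem trunc_totD {U : Opens M} (a : CEAlg E F 𝔤 U) :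
    trunc E F 𝔤 wOnly (totD D U a) = wQ L U a := by
  rw [totD, LinearMap.add_apply, map_add]
  refine add_eq_left.2 (ext_component fun m ↦ ?_)
  by_cases hm : wOnly m
  · rw [component_trunc_of_pos hm, ← component_trunc_of_pos (S := bideg 0 (m 2)) ⟨hm.1, rfl⟩,
      D.D_deg_zero]
  · exact component_trunc_of_neg hm _

theorem totD_res {U V : Opens M} (h : V ≤ U) (a : CEAlg E F 𝔤 U) :
    totD D V (res E F 𝔤 h a) = res E F 𝔤 h (totD D U a) := by
  rw [totD, totD, LinearMap.add_apply, LinearMap.add_apply, L.Q_res, D.D_res, map_add]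

end LInftySpace

variable [FiniteDimensional ℂ E]

theorem koszul_res {U V : Opens M} (h : V ≤ U) (a : CEAlg E F 𝔤 U) :
    koszul E F 𝔤 V (res E F 𝔤 h a) = res E F 𝔤 h (koszul E F 𝔤 U a) :=
  shiftOp_res h (shiftsDeg_secKoszul U) (shiftsDeg_secKoszul V) a

section KoszulHomotopy

variable {U : Opens M} {a : CEAlg E F 𝔤 U}

theorem koszulHomotopy_res {V : Opens M} (h : V ≤ U) (a : CEAlg E F 𝔤 U) :
    koszulHomotopy E F 𝔤 V (res E F 𝔤 h a) = res E F 𝔤 h (koszulHomotopy E F 𝔤 U a) :=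
  (congrArg _ (shiftOp_res h (shiftsDeg_secCoKoszul U) (shiftsDeg_secCoKoszul V) a)).trans
    (weight_res _ h _)

theorem koszulHomotopy_mem_supp {S S' : Deg → Prop}
    (hS : ∀ m, S (m + .single 0 1) → S' (m + .single 1 1)) (ha : a ∈ supp E F 𝔤 U S) :
    koszulHomotopy E F 𝔤 U a ∈ supp E F 𝔤 U S' := by
  refine weight_mem_supp _ (mem_supp_iff.2 fun m hm ↦ ?_)
  by_cases h : .single 1 1 ≤ m
  · obtain ⟨n, rfl⟩ := le_iff_exists_add'.1 h
    rw [component_add_shiftOp, mem_supp_iff.1 ha _ fun h ↦ hm (hS n h), map_zero]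
  · exact component_shiftOp_of_not_le _ h a

theorem koszulHomotopy_mem_symFilt {n : ℕ} (ha : a ∈ supp E F 𝔤 U (symFilt n)) :
    koszulHomotopy E F 𝔤 U a ∈ supp E F 𝔤 U (symFilt (n + 1)) :=
  koszulHomotopy_mem_supp (fun m h ↦ by simpa [symFilt] using h) ha

end KoszulHomotopy

theorem mem_symFilt_of_frameSym_mul {x₀ : M} {V : Opens M} (hV : V ≤ frameDomain E x₀)
    (P : CEAlg E F 𝔤 V →ₗ[ℂ] CEAlg E F 𝔤 V)
    (hP : ∀ n i, ∀ b ∈ supp E F 𝔤 V (symFilt n),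
      P (frameSym F 𝔤 hV i * b) - frameSym F 𝔤 hV i * P b ∈ supp E F 𝔤 V (symFilt (n + 1)))
    (n : ℕ) {a : CEAlg E F 𝔤 V} (ha : a ∈ supp E F 𝔤 V (symFilt n)) :
    P a ∈ supp E F 𝔤 V (symFilt n) := by
  induction n generalizing a with
  | zero => exact fun m hm ↦ absurd (Nat.zero_le _) hm
  | succ n ih =>
    obtain ⟨b, hb, rfl⟩ := exists_sum_frameSym_mul hV ha
    rw [map_sum]
    refine Submodule.sum_mem _ fun i _ ↦ ?_
    have hy : frameSym F 𝔤 hV i ∈ supp E F 𝔤 V (symFilt 1) :=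
      homogeneous_mem_supp _ (by simp [symFilt])
    rw [← sub_add_cancel (P _) (frameSym F 𝔤 hV i * P (b i))]
    exact Submodule.add_mem _ (hP n i (b i) (hb i)) (add_comm 1 n ▸ mul_mem_symFilt hy (ih (hb i)))

section LInftySpace

variable [∀ k, ContMDiffVectorBundle ω (F k) (𝔤 k) 𝓘(ℂ, E)]

section Q

variable (L : LInftyStructure E F 𝔤)

theorem Q_mem_symFilt {U : Opens M} {n : ℕ} {a : CEAlg E F 𝔤 U}
    (ha : a ∈ supp E F 𝔤 U (symFilt n)) : L.Q U a ∈ supp E F 𝔤 U (symFilt n) :=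
  mem_supp_of_locally fun x hx ↦ by
    refine ⟨U ⊓ frameDomain E x, inf_le_left, ⟨hx, mem_frameDomain x⟩, ?_⟩
    rw [← L.Q_res]
    refine mem_symFilt_of_frameSym_mul inf_le_right _ (fun n i b _ ↦ ?_) n (res_mem _ ha)
    rw [frameSym, Q_secSym_mul L (isHolDual_frameCovec inf_le_right i), sub_self]
    exact Submodule.zero_mem _

theorem wQ_eq_zero {U : Opens M} {a : CEAlg E F 𝔤 U}
    (ha : a ∈ supp E F 𝔤 U fun m ↦ ¬ wOnly m) : wQ L U a = 0 := by
  refine ext_component fun m ↦ ?_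
  by_cases hm : wOnly m
  · have h1 : trunc E F 𝔤 (bideg 0 (m 2 + 1)) a ∈ supp E F 𝔤 U (symFilt 1) :=
      supp_mono (fun m' h ↦ Nat.one_le_iff_ne_zero.2 fun h1 ↦ h.1 ⟨h.2.1, h1⟩)
        (trunc_mem_supp_and ha)
    rw [wQ, LinearMap.comp_apply, component_trunc_of_pos hm,
      ← component_trunc_of_pos (S := bideg 0 (m 2)) ⟨hm.1, rfl⟩, L.Q_deg]
    exact mem_supp_iff.1 (Q_mem_symFilt L h1) m (by simp [symFilt, hm.2])
  · exact component_trunc_of_neg hm _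

theorem wQ_trunc {U : Opens M} (a : CEAlg E F 𝔤 U) :
    wQ L U (trunc E F 𝔤 wOnly a) = wQ L U a := by
  conv_rhs => rw [← trunc_add_trunc_not wOnly a, map_add, wQ_eq_zero L (trunc_mem_supp _ a),
    add_zero]

theorem wQ_wQ {U : Opens M} (a : CEAlg E F 𝔤 U) : wQ L U (wQ L U a) = 0 := by
  refine (wQ_trunc L (L.Q U a)).trans ?_
  rw [wQ, LinearMap.comp_apply, L.Q_sq, map_zero]

end Q

variable {L : LInftyStructure E F 𝔤} (D : GrothendieckConnection L)

theorem D_sub_koszul_secSym_mul {V : Opens M} {α : ∀ x : M, TangentSpace 𝓘(ℂ, E) x →L[ℂ] ℂ}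
    (hα : IsHolDual E E V α) (b : CEAlg E F 𝔤 V) :
    (D.D V - koszul E F 𝔤 V) (homogeneous (isHol_secSym hα) * b) -
        homogeneous (isHol_secSym hα) * (D.D V - koszul E F 𝔤 V) b =
      (D.D V (homogeneous (isHol_secSym hα)) - homogeneous (isHol_secForm hα)) * b := by
  rw [LinearMap.sub_apply, LinearMap.sub_apply, koszul_secSym_mul hα,
    D.D_mul V 0 0 _ _ (homogeneous_secSym_mem_bideg hα), add_zero, pow_zero, one_smul, sub_mul,
    mul_sub]
  abel

theorem D_sub_koszul_mem_symFilt {U : Opens M} {n : ℕ} {a : CEAlg E F 𝔤 U}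
    (ha : a ∈ supp E F 𝔤 U (symFilt n)) :
    D.D U a - koszul E F 𝔤 U a ∈ supp E F 𝔤 U (symFilt n) :=
  mem_supp_of_locally fun x hx ↦ by
    refine ⟨U ⊓ frameDomain E x, inf_le_left, ⟨hx, mem_frameDomain x⟩, ?_⟩
    rw [map_sub, ← D.D_res, ← koszul_res]
    refine mem_symFilt_of_frameSym_mul inf_le_right (D.D _ - koszul E F 𝔤 _)
      (fun n i b hb ↦ ?_) n (res_mem _ ha)
    have hα := isHolDual_frameCovec (E := E) (V := U ⊓ frameDomain E x) inf_le_right i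
    rw [frameSym, D_sub_koszul_secSym_mul D hα, add_comm n 1]
    exact mul_mem_symFilt (D_secSym_sub_secForm_mem_symFilt D hα) hb

theorem totD_sub_koszul_mem_symFilt {U : Opens M} {n : ℕ} {a : CEAlg E F 𝔤 U}
    (ha : a ∈ supp E F 𝔤 U (symFilt n)) :
    totD D U a - koszul E F 𝔤 U a ∈ supp E F 𝔤 U (symFilt n) := by
  rw [totD, LinearMap.add_apply, add_sub_assoc]
  exact Submodule.add_mem _ (Q_mem_symFilt L ha) (D_sub_koszul_mem_symFilt D ha)

end LInftySpace

end Series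

/-! ### The extension of complexes -/

section Complexes

variable {E : Type*} [NormedAddCommGroup E] [NormedSpace ℂ E]
  {M : Type*} [TopologicalSpace M] [ChartedSpace E M] [IsManifold 𝓘(ℂ, E) ω M]
  {r : ℕ} {F : Fin r → Type*} [∀ k, NormedAddCommGroup (F k)] [∀ k, NormedSpace ℂ (F k)]
  {𝔤 : Fin r → M → Type*} [∀ k, TopologicalSpace (TotalSpace (F k) (𝔤 k))]
  [∀ k x, AddCommGroup (𝔤 k x)] [∀ k x, Module ℂ (𝔤 k x)] [∀ k x, TopologicalSpace (𝔤 k x)]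
  [∀ k x, IsTopologicalAddGroup (𝔤 k x)] [∀ k x, ContinuousSMul ℂ (𝔤 k x)]
  [∀ k, FiberBundle (F k) (𝔤 k)] [∀ k, VectorBundle ℂ (F k) (𝔤 k)]

theorem isCompleteFiltration_symFilt (U : Opens M) (S : Deg → Prop) :
    IsCompleteFiltration (R := ℂ) (A := supp E F 𝔤 U S) fun n ↦
      (supp E F 𝔤 U (symFilt n)).comap (supp E F 𝔤 U S).subtype where
  zero_eq_top := eq_top_iff.2 fun _ _ _ hm ↦ absurd (Nat.zero_le _) hm
  antitone _ _ h _ ha := supp_mono (fun _ ↦ h.trans) ha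
  eq_zero_of_forall_mem a ha :=
    Subtype.ext (ext_component fun m ↦ ha (m 1 + 1) m (Nat.not_succ_le_self _))
  exists_limit s hs := by
    refine ⟨⟨⟨fun m ↦ component m (s (m 1 + 1)).1, fun m ↦ isHol_component m _⟩,
      fun m hm ↦ (s (m 1 + 1)).2 m hm⟩, fun n m hm ↦ ?_⟩
    have stable (k : ℕ) (hk : m 1 + 1 ≤ k) :
        component m (s (m 1 + 1)).1 = component m (s k).1 := by
      induction k, hk using Nat.le_induction with
      | base => rfl
      | succ k hk ih =>
        have h := mem_supp_iff.1 (hs k) m (not_le.2 hk)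
        rwa [Submodule.subtype_apply, Submodule.coe_sub, map_sub, sub_eq_zero, eq_comm, ← ih] at h
    exact sub_eq_zero.2 (stable n (not_le.1 hm))

/-- Multidegrees of total degree `n` with at least one factor from `Ω_M`. -/
def kerDeg (n : ℤ) (m : Deg) : Prop := totDeg n m ∧ ¬ wOnly m

theorem totDeg_of_wDeg {n : ℤ} {m : Deg} (h : wDeg n m) : totDeg n m := by
  simpa [totDeg, h.1.1] using h.2

theorem wDeg_of_totDeg {n : ℤ} {m : Deg} (h : totDeg n m ∧ wOnly m) : wDeg n m :=
  ⟨h.2, by simpa [totDeg, h.2.1] using h.1⟩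

section

variable [∀ k, ContMDiffVectorBundle ω (F k) (𝔤 k) 𝓘(ℂ, E)]

theorem isIso_suppMap {S : Deg → Prop}
    {f : ∀ U : Opens M, CEAlg E F 𝔤 U →ₗ[ℂ] CEAlg E F 𝔤 U}
    (hres : ∀ {U V : Opens M} (h : V ≤ U) (a : CEAlg E F 𝔤 U),
      f V (res E F 𝔤 h a) = res E F 𝔤 h (f U a))
    (hS : ∀ (U : Opens M) (a : CEAlg E F 𝔤 U), a ∈ supp E F 𝔤 U S → f U a ∈ supp E F 𝔤 U S)
    (hf : ∀ U n, ∀ a ∈ supp E F 𝔤 U S, a ∈ supp E F 𝔤 U (symFilt n) →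
      f U a - a ∈ supp E F 𝔤 U (symFilt (n + 1))) :
    IsIso (suppMap f hres hS) := by
  have (U : (Opens M)ᵒᵖ) : IsIso ((suppMap f hres hS).app U) :=
    (ConcreteCategory.isIso_iff_bijective _).2
      ((isCompleteFiltration_symFilt U.unop S).bijective (f := (f U.unop).restrict (hS U.unop))
        fun n a ha ↦ hf U.unop n a.1 a.2 ha)
  exact NatIso.isIso_of_isIso_app _

variable {L : LInftyStructure E F 𝔤} (D : GrothendieckConnection L)

theorem ceComplex_d {i j : ℤ} (hij : i + 1 = j) : (ceComplex D).d i j =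
    suppMap (totD D) (totD_res D) (fun _ _ ha ↦ totD_mem D hij ha) :=
  dif_pos hij

theorem wComplex_d
    (hL : ∀ (n : ℤ) (U : Opens M), ∀ a ∈ supp E F 𝔤 U (wDeg n), wQ L U (wQ L U a) = 0)
    {i j : ℤ} (hij : i + 1 = j) : (wComplex L hL).d i j =
      suppMap (wQ L) (wQ_res L) (fun _ _ ha ↦ wQ_mem L hij ha) :=
  dif_pos hij

end

variable [FiniteDimensional ℂ E]

theorem koszulHomotopy_mem_kerDeg {U : Opens M} {i j : ℤ} (hij : i + 1 = j) {a : CEAlg E F 𝔤 U}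
    (ha : a ∈ supp E F 𝔤 U (kerDeg j)) : koszulHomotopy E F 𝔤 U a ∈ supp E F 𝔤 U (kerDeg i) :=
  koszulHomotopy_mem_supp (fun m h ↦ by
    have := h.1
    simp only [kerDeg, totDeg, wOnly] at this ⊢
    simp at this ⊢
    omega) ha

variable [∀ k, ContMDiffVectorBundle ω (F k) (𝔤 k) 𝓘(ℂ, E)]
  {L : LInftyStructure E F 𝔤} (D : GrothendieckConnection L)

theorem totD_mem_kerDeg {U : Opens M} {i j : ℤ} (hij : i + 1 = j) {a : CEAlg E F 𝔤 U}
    (ha : a ∈ supp E F 𝔤 U (kerDeg i)) : totD D U a ∈ supp E F 𝔤 U (kerDeg j) := by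
  intro m hm
  by_cases hw : wOnly m
  · have h := trunc_totD D a
    rw [wQ_eq_zero L (supp_mono (fun _ ↦ And.right) ha)] at h
    exact (component_trunc_of_pos hw _).symm.trans (congrArg (component m) h)
  · exact totD_mem D hij (supp_mono (fun _ ↦ And.left) ha) m fun h ↦ hm ⟨h, hw⟩

/-- The kernel of the projection of the Chevalley--Eilenberg complex to `(Ŝ(𝒲), Q)`. -/
def kerComplex : CochainComplex (TopCat.Presheaf (ModuleCat ℂ) (TopCat.of M)) ℤ where
  X n := suppSheaf E F 𝔤 (kerDeg n)
  d i j := if h : i + 1 = j then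
      suppMap (totD D) (totD_res D) (fun _ _ ha ↦ totD_mem_kerDeg D h ha)
    else 0
  shape i j h := dif_neg h
  d_comp_d' i j k hij hjk := by
    rw [dif_pos (show i + 1 = j from hij), dif_pos (show j + 1 = k from hjk)]
    ext U a
    exact Subtype.ext (totD_totD D _ _)

theorem kerComplex_d {i j : ℤ} (hij : i + 1 = j) : (kerComplex D).d i j =
    suppMap (totD D) (totD_res D) (fun _ _ ha ↦ totD_mem_kerDeg D hij ha) :=
  dif_pos hij

section Extension

variable (hL : ∀ (n : ℤ) (U : Opens M), ∀ a ∈ supp E F 𝔤 U (wDeg n), wQ L U (wQ L U a) = 0)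

/-- The inclusion of the kernel in the Chevalley--Eilenberg complex. -/
def kerIncl : kerComplex D ⟶ ceComplex D where
  f n := suppMap (fun _ ↦ LinearMap.id) (fun _ _ ↦ rfl) fun _ _ ha ↦ supp_mono (fun _ ↦ And.left) ha
  comm' i j hij := by
    rw [ceComplex_d D hij, kerComplex_d D hij]
    rfl

/-- The projection of the Chevalley--Eilenberg complex to `(Ŝ(𝒲), Q)`. -/
def projHom : ceComplex D ⟶ wComplex L hL where
  f n := suppMap (fun _ ↦ trunc E F 𝔤 wOnly) (trunc_res wOnly)
    fun _ _ ha ↦ supp_mono (fun _ ↦ wDeg_of_totDeg) (trunc_mem_supp_and ha)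
  comm' i j hij := by
    rw [ceComplex_d D hij, wComplex_d hL hij]
    ext U a
    exact Subtype.ext ((wQ_trunc L a.1).trans (trunc_totD D a.1).symm)

/-- The extension of `(Ŝ(𝒲), Q)` by the kernel, given by the Chevalley--Eilenberg complex. -/
def ceExtension : ShortComplex (CochainComplex (TopCat.Presheaf (ModuleCat ℂ) (TopCat.of M)) ℤ) :=
  .mk (kerIncl D) (projHom D hL) (by
    ext n U a
    exact Subtype.ext (trunc_eq_zero (fun _ hw h ↦ h.2 hw) a.2))

/-- In each degree the Chevalley--Eilenberg complex is the direct sum of the kernel and `Ŝ(𝒲)`. -/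
def ceExtensionSplitting (n : ℤ) :
    ((ceExtension D hL).map (HomologicalComplex.eval _ (ComplexShape.up ℤ) n)).Splitting where
  r := suppMap (fun _ ↦ trunc E F 𝔤 fun m ↦ ¬ wOnly m) (trunc_res _)
    fun _ _ ha ↦ trunc_mem_supp_and ha
  s := suppMap (fun _ ↦ LinearMap.id) (fun _ _ ↦ rfl)
    fun _ _ ha ↦ supp_mono (fun _ ↦ totDeg_of_wDeg) ha
  f_r := by
    ext U a
    exact Subtype.ext (trunc_eq_self (supp_mono (fun _ ↦ And.right) a.2))
  s_g := by
    ext U a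
    exact Subtype.ext (trunc_eq_self (supp_mono (fun _ ↦ And.left) a.2))
  id := by
    ext U a
    exact Subtype.ext ((add_comm _ _).trans (trunc_add_trunc_not wOnly a.1))

end Extension

/-- The Koszul homotopy as a map of degree `-1` of the kernel. -/
def kerHomotopy (i j : ℤ) (hij : (ComplexShape.up ℤ).Rel j i) :
    (kerComplex D).X i ⟶ (kerComplex D).X j :=
  suppMap (koszulHomotopy E F 𝔤) koszulHomotopy_res
    fun _ _ ha ↦ koszulHomotopy_mem_kerDeg hij ha

theorem totD_homotopy_sub_mem_symFilt {U : Opens M} {n : ℕ} {a : CEAlg E F 𝔤 U}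
    (ha : a ∈ supp E F 𝔤 U (symFilt n)) :
    koszulHomotopy E F 𝔤 U (totD D U a) + totD D U (koszulHomotopy E F 𝔤 U a) -
      (a - trunc E F 𝔤 wOnly a) ∈ supp E F 𝔤 U (symFilt (n + 1)) := by
  have hH := koszulHomotopy_mem_symFilt (totD_sub_koszul_mem_symFilt D ha)
  have hD := totD_sub_koszul_mem_symFilt D (koszulHomotopy_mem_symFilt ha)
  convert Submodule.add_mem _ hH hD using 1
  rw [← koszul_koszulHomotopy_add, map_sub]
  abel

theorem nullHomotopicMap_kerHomotopy_f (n : ℤ) :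
    (Homotopy.nullHomotopicMap' (kerHomotopy D)).f n =
      suppMap (fun U ↦ koszulHomotopy E F 𝔤 U ∘ₗ totD D U + totD D U ∘ₗ koszulHomotopy E F 𝔤 U)
        (fun h a ↦ by
          simp only [LinearMap.add_apply, LinearMap.comp_apply, totD_res, koszulHomotopy_res,
            map_add])
        (fun _ _ ha ↦ Submodule.add_mem _
          (koszulHomotopy_mem_kerDeg rfl (totD_mem_kerDeg D rfl ha))
          (totD_mem_kerDeg D (sub_add_cancel n 1)
            (koszulHomotopy_mem_kerDeg (sub_add_cancel n 1) ha))) := by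
  have prev : (ComplexShape.up ℤ).Rel (n - 1) n := sub_add_cancel n 1
  have next : (ComplexShape.up ℤ).Rel n (n + 1) := rfl
  refine (Homotopy.nullHomotopicMap'_f prev next (kerHomotopy D)).trans ?_
  rw [kerComplex_d D next, kerComplex_d D prev]
  rfl

theorem isIso_nullHomotopicMap_kerHomotopy :
    IsIso (Homotopy.nullHomotopicMap' (kerHomotopy D)) := by
  have (n : ℤ) : IsIso ((Homotopy.nullHomotopicMap' (kerHomotopy D)).f n) := by
    rw [nullHomotopicMap_kerHomotopy_f]
    refine isIso_suppMap _ _ fun U k a hker ha ↦ ?_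
    have h := totD_homotopy_sub_mem_symFilt D ha
    rwa [trunc_eq_zero (fun _ hw h ↦ h.2 hw) hker, sub_zero] at h
  exact HomologicalComplex.Hom.isIso_of_components _

end Complexes

end LInfty

end

theorem theorem3p6_general
    {E : Type*} [NormedAddCommGroup E] [NormedSpace ℂ E] [FiniteDimensional ℂ E]
    {M : Type*} [TopologicalSpace M] [ChartedSpace E M] [IsManifold 𝓘(ℂ, E) ω M]
    {r : ℕ} (F : Fin r → Type*) [∀ k, NormedAddCommGroup (F k)] [∀ k, NormedSpace ℂ (F k)]
    (𝔤 : Fin r → M → Type*) [∀ k, TopologicalSpace (TotalSpace (F k) (𝔤 k))]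
    [∀ k x, AddCommGroup (𝔤 k x)] [∀ k x, Module ℂ (𝔤 k x)] [∀ k x, TopologicalSpace (𝔤 k x)]
    [∀ k x, IsTopologicalAddGroup (𝔤 k x)] [∀ k x, ContinuousSMul ℂ (𝔤 k x)]
    [∀ k, FiberBundle (F k) (𝔤 k)] [∀ k, VectorBundle ℂ (F k) (𝔤 k)]
    [∀ k, ContMDiffVectorBundle ω (F k) (𝔤 k) 𝓘(ℂ, E)]
    (L : LInfty.LInftyStructure E F 𝔤) (D : LInfty.GrothendieckConnection L) :
    ∃ hL : ∀ (n : ℤ) (U : Opens M), ∀ a ∈ LInfty.supp E F 𝔤 U (LInfty.wDeg n),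
        LInfty.wQ L U (LInfty.wQ L U a) = 0,
      Nonempty (HomotopyEquiv (LInfty.ceComplex D) (LInfty.wComplex L hL)) :=
  ⟨fun _ _ a _ ↦ LInfty.wQ_wQ L a,
    LInfty.nonempty_homotopyEquiv_of_degreewise_split
      (LInfty.ceExtension D fun _ _ a _ ↦ LInfty.wQ_wQ L a)
      (LInfty.ceExtensionSplitting D _) (LInfty.isIso_nullHomotopicMap_kerHomotopy D)
      (Homotopy.nullHomotopy' (LInfty.kerHomotopy D))⟩

theorem theorem3p6
    {E : Type*} [NormedAddCommGroup E] [NormedSpace ℂ E] [FiniteDimensional ℂ E]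
    {M : Type*} [TopologicalSpace M] [ChartedSpace E M] [IsManifold 𝓘(ℂ, E) ω M]
    {r : ℕ} (F : Fin r → Type*) [∀ k, NormedAddCommGroup (F k)] [∀ k, NormedSpace ℂ (F k)]
    [∀ k, FiniteDimensional ℂ (F k)]
    (𝔤 : Fin r → M → Type*) [∀ k, TopologicalSpace (TotalSpace (F k) (𝔤 k))]
    [∀ k x, AddCommGroup (𝔤 k x)] [∀ k x, Module ℂ (𝔤 k x)] [∀ k x, TopologicalSpace (𝔤 k x)]
    [∀ k x, IsTopologicalAddGroup (𝔤 k x)] [∀ k x, ContinuousSMul ℂ (𝔤 k x)]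
    [∀ k, FiberBundle (F k) (𝔤 k)] [∀ k, VectorBundle ℂ (F k) (𝔤 k)]
    [∀ k, ContMDiffVectorBundle ω (F k) (𝔤 k) 𝓘(ℂ, E)]
    (L : LInfty.LInftyStructure E F 𝔤) (D : LInfty.GrothendieckConnection L) :
    ∃ hL : ∀ (n : ℤ) (U : Opens M), ∀ a ∈ LInfty.supp E F 𝔤 U (LInfty.wDeg n),
        LInfty.wQ L U (LInfty.wQ L U a) = 0,
      Nonempty (HomotopyEquiv (LInfty.ceComplex D) (LInfty.wComplex L hL)) :=
  theorem3p6_general F 𝔤 L D
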